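/- **Setting.** Let $x,y,z,w$ be homogeneous coordinates on $\mathbb{RP}^3$, let $L_\infty=\{z=w=0\}$, and identify $\{w\neq 0\}$ with $\mathbb R^3$. Let $\mathbb B\subset\mathbb{RP}^3$ be a convex-concave body with respect to $L_\infty$. This means that $\mathbb B$ is closed and disjoint from $L_\infty$, that its section by every plane $N\supset L_\infty$ is a convex subset of the affine plane $N\setminus L_\infty$, and that for any three distinct planes through $L_\infty$, through every point of the section by one of them there passes a line meeting the sections by the other two. Let $t_1<\dots<t_m$, let $L_i=\{z=t_i\}$ and $S_i=\mathbb B\cap L_i$. Let $H_i\subset L_i$ be a closed half-plane whose boundary line passes through the point $(0,0,t_i)$ of the $z$-axis, and suppose that $S_i$ lies in the relative interior of $H_i$ in $L_i$. Suppose also that the boundary lines $\partial H_i$ are pairwise non-parallel. Let $\pi$ be the projection $(x,y,z)\mapsto(x,y)$; all horizontal planes are identified with $\mathbb R^2$ by means of $\pi$. Write $\pi(H_i)^c$ for the closure of $\mathbb R^2\setminus\pi(H_i)$, $B_i=\pi^{-1}(\pi(H_i))$, and $B_i^c$ for the closure of $\mathbb R^3\setminus B_i$. A code of the configuration is obtained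 by choosing an orientation of the unit circle of $\mathbb R^2$ and a point $N$ of the circle on none of the lines $\partial\pi(H_i)$. Going around the circle from $N$, one writes down the numbers of the first $m$ boundary lines met, each number $i$ with the sign $+$ if $N\in\pi(H_i)$ and $-$ otherwise. **Theorem (Sectorial Browder theorem).** Let $i_1<i_2<i_3<i_4$ be indices, written $1,2,3,4$ below. Consider the conditions 1. $\pi(H_1)\cap\pi(H_4)^c\subset\pi(H_2)^c$, 2. $\pi(H_3)\cap\pi(H_2)\subset\pi(H_4)^c$. (a) Conditions 1 and 2 both hold if and only if some code of the configuration contains the subsequence $1{+}\,2{-}\,3{+}\,4{-}$. (b) Suppose that 1 and 2 hold and that $\pi(S_1)\cap\pi(H_4)^c\neq\emptyset$. Then $\pi(S_2)\cap\pi(H_3)$, $\pi(S_3)\cap\pi(H_2)$ and $\pi(S_4)\cap\pi(H_1)^c$ are non-empty, and there is a straight line in $\mathbb R^3$ that meets all of $S_1\cap B_4^c$, $S_2\cap B_3$, $S_3\cap B_2$ and $S_4\cap B_1^c$. (c) Under the assumptions of (b), let $l$ be any such line, meeting these four sets at points with projections $A',B',C',D'$ respectively. Then $\pi(l)$ meets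 each of $\partial\pi(H_1),\partial\pi(H_2),\partial\pi(H_3),\partial\pi(H_4)$ in exactly one point; these points $A,B,C,D$ are pairwise distinct. For the double ratio $(A,B,C,D)=\frac{AB}{BD}:\frac{AC}{CD}$ of lengths, $(A',B',C',D')$ equals the double ratio of the distances between the planes, $$\frac{h_1}{h_2+h_3}:\frac{h_1+h_2}{h_3},\qquad h_k=t_{i_{k+1}}-t_{i_k},$$ and $(A,B,C,D)$ equals the double ratio of the directions of the boundary lines, $$\frac{[d_1,d_2]}{[d_2,d_4]}:\frac{[d_1,d_3]}{[d_3,d_4]},$$ where $d_k$ is a direction vector of $\partial H_k$ and $[\cdot,\cdot]$ is the determinant of two vectors of $\mathbb R^2$. The double ratio of the distances is strictly greater than the double ratio of the directions: $$\frac{h_1}{h_2+h_3}:\frac{h_1+h_2}{h_3}\;>\;\frac{[d_1,d_2]}{[d_2,d_4]}:\frac{[d_1,d_3]}{[d_3,d_4]}.$$ -/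

import Mathlib

open Set Module
open scoped LinearAlgebra.Projectivization InnerProductSpace

noncomputable section

namespace SectorialBrowder

/-- The vector space underlying real projective 3-space; homogeneous coordinates `(x, y, z, w)`. -/
abbrev V4 : Type := Fin 4 → ℝ

/-- Real projective 3-space. -/
abbrev RP3 : Type := ℙ ℝ V4

/-- Affine 3-space with coordinates `(x, y, z)` and its Euclidean metric. -/
abbrev E3 : Type := EuclideanSpace ℝ (Fin 3)

/-- The `(x, y)`-plane, which stands for every horizontal plane by means of the coordinates
`x, y`. -/
abbrev E2 : Type := EuclideanSpace ℝ (Fin 2)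

/-! ### Projective convex-concave bodies -/

/-- The points of a projective subspace, given by the linear subspace `W`. -/
def projPoints (W : Submodule ℝ V4) : Set RP3 := {p | p.submodule ≤ W}

/-- `𝔹` is a closed set in `RP3` (quotient topology), disjoint from the line `L`, such that
* the section by every plane `N` through `L` is convex in the affine plane `N \ L`; this affine
  plane is realized as `{v ∈ N | f v = 1}` for a linear form `f` that vanishes on `L`
  (if `f` vanishes on `N` the set is empty, otherwise different `f` give proportional sets);
* for any three different planes through `L`, through every point of the section by one of them
  passes a line that meets the sections by the two others. -/
structure IsConvexConcave (L : Submodule ℝ V4) (𝔹 : Set RP3) : Prop where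
  isClosed : IsClosed {v : {v : V4 // v ≠ 0} | Projectivization.mk' ℝ v ∈ 𝔹}
  disjoint : Disjoint 𝔹 (projPoints L)
  convex : ∀ N : Submodule ℝ V4, finrank ℝ N = 3 → L ≤ N →
    ∀ f : V4 →ₗ[ℝ] ℝ, (∀ v ∈ L, f v = 0) →
      Convex ℝ {v : V4 | v ∈ N ∧ f v = 1 ∧ ∃ hv : v ≠ 0, Projectivization.mk ℝ v hv ∈ 𝔹}
  lines : ∀ N₁ N₂ N₃ : Submodule ℝ V4,
    finrank ℝ N₁ = 3 → finrank ℝ N₂ = 3 → finrank ℝ N₃ = 3 →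
    L ≤ N₁ → L ≤ N₂ → L ≤ N₃ → N₁ ≠ N₂ → N₁ ≠ N₃ → N₂ ≠ N₃ →
    ∀ p ∈ 𝔹 ∩ projPoints N₁, ∃ l : Submodule ℝ V4, finrank ℝ l = 2 ∧ p ∈ projPoints l ∧
      (projPoints l ∩ (𝔹 ∩ projPoints N₂)).Nonempty ∧
      (projPoints l ∩ (𝔹 ∩ projPoints N₃)).Nonempty

/-- The infinite line `z = w = 0`. -/
def infiniteLine : Submodule ℝ V4 where
  carrier := {v | v 2 = 0 ∧ v 3 = 0}
  add_mem' := by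
    rintro a b ⟨ha, ha'⟩ ⟨hb, hb'⟩
    simp [ha, ha', hb, hb']
  zero_mem' := by simp
  smul_mem' := by
    rintro c a ⟨ha, ha'⟩
    simp [ha, ha']

/-- The affine chart `(x, y, z) ↦ [x : y : z : 1]`. -/
def chart (p : E3) : RP3 :=
  Projectivization.mk ℝ ![p 0, p 1, p 2, 1] (fun h => by simpa using congrFun h 3)

/-- The section of `𝔹` by the horizontal plane `z = t`, in the affine chart. -/
def horizontalSection (𝔹 : Set RP3) (t : ℝ) : Set E3 := {p | p 2 = t ∧ chart p ∈ 𝔹}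

/-! ### Half-planes, projection along the `z`-axis -/

/-- The projection along the `z`-axis. -/
def proj (p : E3) : E2 := !₂[p 0, p 1]

/-- The closed half-plane of the plane `z = t` with inner normal `u` whose boundary line passes
through the point `(0, 0, t)` of the `z`-axis. -/
def halfPlane (u : E2) (t : ℝ) : Set E3 := {p | p 2 = t ∧ 0 ≤ ⟪u, proj p⟫_ℝ}

/-- The closure of the complement of the projection of `H`. -/
def projCompl (H : Set E3) : Set E2 := closure (proj '' H)ᶜ

/-- The full preimage of the projection of `H`. -/
def halfSpace (H : Set E3) : Set E3 := proj ⁻¹' (proj '' H)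

/-- The closure of the complement of `halfSpace H`. -/
def halfSpaceCompl (H : Set E3) : Set E3 := closure (halfSpace H)ᶜ

/-! ### Codes -/

/-- The point of the unit circle with polar angle `φ`. -/
def circlePoint (φ : ℝ) : E2 := !₂[Real.cos φ, Real.sin φ]

/-- `c` is the code of the half-planes `K i` of `E2` (with boundary lines through the origin) for
the base point `circlePoint φ` and the orientation `ε = ±1` of the unit circle. Going around the
circle from the base point, one meets each boundary line exactly once before half a turn, and these
are the first `m` of the `2 * m` intersection points of the circle with the boundary lines. The code
lists the indices in the order in which they are met, each with the sign `true` if `K i`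
contains the base point and `false` otherwise. -/
structure IsCode {m : ℕ} (K : Fin m → Set E2) (φ ε : ℝ) (c : List (Fin m × Bool)) : Prop where
  orientation : ε = 1 ∨ ε = -1
  base : ∀ i, circlePoint φ ∉ frontier (K i)
  all : ∀ i, i ∈ c.map Prod.fst
  order : ∃ θ : Fin m → ℝ,
    (∀ i, 0 < θ i ∧ θ i < Real.pi ∧ circlePoint (φ + ε * θ i) ∈ frontier (K i)) ∧
    c.Pairwise (fun a b => θ a.1 < θ b.1)
  sign : ∀ a ∈ c, (a.2 = true ↔ circlePoint φ ∈ K a.1)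

/-! ### Double ratios -/

/-- The double ratio `(AB / BD) : (AC / CD)` of four points, in terms of lengths. -/
def doubleRatio (A B C D : E2) : ℝ := (dist A B / dist B D) / (dist A C / dist C D)

/-- The direction vector of the line through the origin with normal vector `u`. -/
def boundaryDir (u : E2) : E2 := !₂[-u 1, u 0]

/-- The determinant of two vectors of the plane. -/
def det2 (a b : E2) : ℝ := a 0 * b 1 - a 1 * b 0

/-- The double ratio of the four concurrent lines with direction vectors `a, b, c, d`; the
determinants may be replaced by the sines of the oriented angles between the lines. -/
def directionRatio (a b c d : E2) : ℝ :=
  (det2 a b / det2 b d) / (det2 a c / det2 c d)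

/-- The double ratio of the distances between the planes `z = s₁`, `z = s₂`, `z = s₃`, `z = s₄`. -/
def heightRatio (s₁ s₂ s₃ s₄ : ℝ) : ℝ :=
  ((s₂ - s₁) / (s₄ - s₂)) / ((s₃ - s₁) / (s₄ - s₃))

end SectorialBrowder

end

open SectorialBrowder

/-!
Parametrize a non-horizontal line by the height: it becomes an affine map `g : ℝ →ᵃ[ℝ] E2`, and the
convexity-concavity of the body says that through each point of a section passes such a line
meeting any two other sections.

Existence. On pairs `(x, y)` with `x ∈ S₁`, `y ∈ S₃`, consider the relation `P`, that the line
through them meets `S₂`, and the relation `Q`, that it meets `S₄`. Both are convex. If they did not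
meet, a linear functional would separate them; starting at an `x` where its `x`-part is maximal and
going forth along `P` and back along `Q` would increase that part. Here `S₁` and `S₃` are first cut
down to the sectors required of the line. This is harmless, since the sector conditions force a line
that starts in the right sector to arrive in the right sector.

Inequality. The sector conditions force every such line to cross the first two boundary lines, in
this order, between the first two planes, and the last two between the last two planes. The double
ratio of heights decreases when the two outer pairs are moved inwards in this way. The double ratio
of the crossing points is that of the pencil of boundary lines, since `det2` of two normals is
proportional to the difference of the crossing parameters.
-/

namespace SectorialBrowder

/-! ### Common transversals of convex sets -/

section ConvexRelation

variable {E F : Type*} [AddCommGroup E] [Module ℝ E] [TopologicalSpace E]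
  [IsTopologicalAddGroup E] [ContinuousSMul ℝ E] [LocallyConvexSpace ℝ E]
  [AddCommGroup F] [Module ℝ F] [TopologicalSpace F]
  [IsTopologicalAddGroup F] [ContinuousSMul ℝ F] [LocallyConvexSpace ℝ F]

/- If `f` separated `P` from `Q`, then going from `x` to `y` along `P` and back to `x'` along `Q`
would increase `f (·, 0)`, which has a maximum on `X`. -/
theorem inter_nonempty_of_convex_relations {X : Set E} {Y : Set F} {P Q : Set (E × F)}
    (hX : IsCompact X) (hX₀ : X.Nonempty)
    (hP : IsCompact P) (hPc : Convex ℝ P) (hQ : IsClosed Q) (hQc : Convex ℝ Q)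
    (hXY : ∀ x ∈ X, ∃ y ∈ Y, (x, y) ∈ P) (hYX : ∀ y ∈ Y, ∃ x ∈ X, (x, y) ∈ Q) :
    (P ∩ Q).Nonempty := by
  rw [← not_disjoint_iff_nonempty_inter]
  intro hdisj
  obtain ⟨f, a, b, hfP, hab, hfQ⟩ := geometric_hahn_banach_compact_closed hPc hP hQc hQ hdisj
  obtain ⟨x, hx, hmax⟩ := hX.exists_isMaxOn hX₀
    (f.comp (ContinuousLinearMap.inl ℝ E F)).continuous.continuousOn
  obtain ⟨y, hy, hxy⟩ := hXY x hx
  obtain ⟨x', hx', hx'y⟩ := hYX y hy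
  have hsplit : ∀ z, f (z, y) = f (z, 0) + f (0, y) := fun z => by rw [← map_add]; simp
  have hlt : f (x, y) < f (x', y) := (hfP _ hxy).trans (hab.trans (hfQ _ hx'y))
  rw [hsplit x, hsplit x', add_lt_add_iff_right] at hlt
  exact hlt.not_ge (hmax hx')

end ConvexRelation

section Interpolant

variable {k E : Type*} [Field k] [AddCommGroup E] [Module k E]

/-- The affine map that takes the values `x` at `s` and `y` at `t`, where `s ≠ t`. An affine map
`g : ℝ →ᵃ[ℝ] E` encodes the non-horizontal line in `E × ℝ` that passes over `g s` at height `s`. -/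
def interpolant (s t : k) (x y : E) : k →ᵃ[k] E :=
  (AffineMap.lineMap x y).comp ((t - s)⁻¹ • (AffineMap.id k k - AffineMap.const k k s))

theorem interpolant_apply (s t : k) (x y : E) (r : k) :
    interpolant s t x y r = AffineMap.lineMap x y ((t - s)⁻¹ * (r - s)) := rfl

@[simp] theorem interpolant_left (s t : k) (x y : E) : interpolant s t x y s = x := by
  simp [interpolant_apply]

theorem interpolant_right {s t : k} (hst : s ≠ t) (x y : E) : interpolant s t x y t = y := by
  simp [interpolant_apply, sub_ne_zero.2 hst.symm]

theorem interpolant_self {s t : k} (hst : s ≠ t) (g : k →ᵃ[k] E) :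
    interpolant s t (g s) (g t) = g := by
  ext r
  rw [interpolant_apply, ← AffineMap.apply_lineMap, AffineMap.lineMap_apply_ring']
  congr 1
  have := sub_ne_zero.2 hst.symm
  field_simp
  ring

end Interpolant

section Transversal

variable {E : Type*} [AddCommGroup E] [Module ℝ E] [TopologicalSpace E]
  [IsTopologicalAddGroup E] [ContinuousSMul ℝ E]

theorem exists_continuousLinearMap_eq_interpolant (s t r : ℝ) :
    ∃ A : E × E →L[ℝ] E, ∀ p, A p = interpolant s t p.1 p.2 r :=
  ⟨(1 - (t - s)⁻¹ * (r - s)) • .fst ℝ E E + ((t - s)⁻¹ * (r - s)) • .snd ℝ E E,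
    fun p => by simp [interpolant_apply, AffineMap.lineMap_apply_module]⟩

variable [LocallyConvexSpace ℝ E]

theorem exists_affineMap_transversal {S₁ S₂ S₃ S₄ : Set E} {t₁ t₂ t₃ t₄ : ℝ} (h₁₃ : t₁ ≠ t₃)
    (hS₁ : IsCompact S₁) (hS₂ : IsClosed S₂) (hS₃ : IsCompact S₃) (hS₄ : IsClosed S₄)
    (hC₁ : Convex ℝ S₁) (hC₂ : Convex ℝ S₂) (hC₃ : Convex ℝ S₃) (hC₄ : Convex ℝ S₄)
    (hne : S₁.Nonempty)
    (hfwd : ∀ x ∈ S₁, ∃ g : ℝ →ᵃ[ℝ] E, g t₁ = x ∧ g t₂ ∈ S₂ ∧ g t₃ ∈ S₃)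
    (hbwd : ∀ x ∈ S₃, ∃ g : ℝ →ᵃ[ℝ] E, g t₃ = x ∧ g t₁ ∈ S₁ ∧ g t₄ ∈ S₄) :
    ∃ g : ℝ →ᵃ[ℝ] E, g t₁ ∈ S₁ ∧ g t₂ ∈ S₂ ∧ g t₃ ∈ S₃ ∧ g t₄ ∈ S₄ := by
  obtain ⟨A₂, hA₂⟩ := exists_continuousLinearMap_eq_interpolant (E := E) t₁ t₃ t₂
  obtain ⟨A₄, hA₄⟩ := exists_continuousLinearMap_eq_interpolant (E := E) t₁ t₃ t₄
  obtain ⟨p, ⟨⟨hp₁, hp₃⟩, hp₂⟩, hp₄⟩ := inter_nonempty_of_convex_relations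
    (Y := S₃) (P := S₁ ×ˢ S₃ ∩ A₂ ⁻¹' S₂) (Q := A₄ ⁻¹' S₄) hS₁ hne
    ((hS₁.prod hS₃).inter_right (hS₂.preimage A₂.continuous))
    ((hC₁.prod hC₃).inter (hC₂.linear_preimage A₂.toLinearMap))
    (hS₄.preimage A₄.continuous) (hC₄.linear_preimage A₄.toLinearMap)
    (fun x hx => by
      obtain ⟨g, rfl, hg₂, hg₃⟩ := hfwd x hx
      exact ⟨g t₃, hg₃, ⟨hx, hg₃⟩, by simpa [hA₂, interpolant_self h₁₃] using hg₂⟩)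
    (fun y hy => by
      obtain ⟨g, rfl, hg₁, hg₄⟩ := hbwd y hy
      exact ⟨g t₁, hg₁, by simpa [hA₄, interpolant_self h₁₃] using hg₄⟩)
  refine ⟨interpolant t₁ t₃ p.1 p.2, by simpa using hp₁, hA₂ p ▸ hp₂, ?_, hA₄ p ▸ hp₄⟩
  rwa [interpolant_right h₁₃]

end Transversal

/-! ### Horizontal sections of a convex-concave body -/

/-- The affine form of the convex-concave condition: `S t` is the section at height `t`, and an
affine map `g` encodes the non-horizontal line that passes over `g t` at height `t`. -/
structure IsConvexConcaveFamily {E : Type*} [AddCommGroup E] [Module ℝ E] [TopologicalSpace E]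
    (S : ℝ → Set E) : Prop where
  isCompact : ∀ t, IsCompact (S t)
  convex : ∀ t, Convex ℝ (S t)
  exists_line : ∀ {r s t : ℝ}, r ≠ s → r ≠ t → s ≠ t → ∀ x ∈ S r,
    ∃ g : ℝ →ᵃ[ℝ] E, g r = x ∧ g s ∈ S s ∧ g t ∈ S t

section Cone

/-- The set of homogeneous coordinate vectors of the points of `𝔹`; it does not contain `0`. -/
def cone (𝔹 : Set RP3) : Set V4 := {v | ∃ hv : v ≠ 0, Projectivization.mk ℝ v hv ∈ 𝔹}

variable {𝔹 : Set RP3}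

theorem mk_mem_iff_mem_cone {v : V4} (hv : v ≠ 0) :
    Projectivization.mk ℝ v hv ∈ 𝔹 ↔ v ∈ cone 𝔹 :=
  ⟨fun h => ⟨hv, h⟩, fun ⟨_, h⟩ => h⟩

theorem smul_mem_cone_iff {c : ℝ} (hc : c ≠ 0) {v : V4} : c • v ∈ cone 𝔹 ↔ v ∈ cone 𝔹 := by
  have hmk (hv : v ≠ 0) : Projectivization.mk ℝ (c • v) (smul_ne_zero hc hv) =
      Projectivization.mk ℝ v hv := (Projectivization.mk_eq_mk_iff' ..).2 ⟨c, rfl⟩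
  exact ⟨fun ⟨hcv, h⟩ => ⟨(smul_ne_zero_iff.1 hcv).2, hmk _ ▸ h⟩,
    fun ⟨hv, h⟩ => ⟨smul_ne_zero hc hv, (hmk hv).symm ▸ h⟩⟩

theorem mk_mem_projPoints_iff {W : Submodule ℝ V4} {v : V4} (hv : v ≠ 0) :
    Projectivization.mk ℝ v hv ∈ projPoints W ↔ v ∈ W := by
  rw [projPoints, mem_ofPred_eq, Projectivization.submodule_mk, Submodule.span_singleton_le_iff_mem]

theorem exists_mem_cone_of_mem {W W' : Submodule ℝ V4}
    (h : (projPoints W ∩ (𝔹 ∩ projPoints W')).Nonempty) : ∃ v ∈ cone 𝔹, v ∈ W ∧ v ∈ W' := by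
  obtain ⟨q, hqW, hq, hqW'⟩ := h
  induction q using Projectivization.ind with
  | h v hv =>
    rw [mk_mem_projPoints_iff] at hqW hqW'
    exact ⟨v, ⟨hv, hq⟩, hqW, hqW'⟩

/-- The linear form that vanishes on the cone over the plane `z = t`. -/
def levelForm (t : ℝ) : V4 →ₗ[ℝ] ℝ := LinearMap.proj 2 - t • LinearMap.proj 3

/-- The cone over the plane `z = t`. -/
def levelPlane (t : ℝ) : Submodule ℝ V4 := LinearMap.ker (levelForm t)

theorem mem_levelPlane {t : ℝ} {v : V4} : v ∈ levelPlane t ↔ v 2 = t * v 3 := by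
  rw [levelPlane, LinearMap.mem_ker, ← sub_eq_zero (a := v 2)]; rfl

theorem finrank_levelPlane (t : ℝ) : finrank ℝ (levelPlane t) = 3 := by
  have hne : levelForm t ≠ 0 := fun h => by
    simpa [levelForm] using LinearMap.congr_fun h ![0, 0, 1, 0]
  have := Module.Dual.finrank_ker_add_one_of_ne_zero hne
  rw [finrank_fin_fun] at this
  exact Nat.succ.inj this

theorem infiniteLine_le_levelPlane (t : ℝ) : infiniteLine ≤ levelPlane t := by
  rintro v ⟨h2, h3⟩
  rw [mem_levelPlane, h2, h3, mul_zero]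

theorem levelPlane_injective : Function.Injective levelPlane := by
  intro s t h
  have : (![0, 0, s, 1] : V4) ∈ levelPlane t := h ▸ mem_levelPlane.2 (by simp)
  simpa using mem_levelPlane.1 this

/-- Homogeneous coordinates of the point of the plane `z = t` over `x`. -/
def homogeneous (x : E2) (t : ℝ) : V4 := ![x 0, x 1, t, 1]

theorem homogeneous_ne_zero (x : E2) (t : ℝ) : homogeneous x t ≠ 0 :=
  fun h => by simpa [homogeneous] using congrFun h 3

theorem homogeneous_mem_levelPlane (x : E2) (t : ℝ) : homogeneous x t ∈ levelPlane t :=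
  mem_levelPlane.2 (by simp [homogeneous])

/-- The `(x, y)`-coordinates of the affine point with homogeneous coordinates `v`; meaningful only
for `v 3 ≠ 0`. -/
noncomputable def dehomogenize (v : V4) : E2 := !₂[v 0 / v 3, v 1 / v 3]

theorem homogeneous_dehomogenize {t : ℝ} {v : V4} (hvt : v ∈ levelPlane t) (hv : v 3 ≠ 0) :
    homogeneous (dehomogenize v) t = (v 3)⁻¹ • v := by
  have h2 := mem_levelPlane.1 hvt
  ext i
  fin_cases i
  exacts [div_eq_inv_mul _ _, div_eq_inv_mul _ _,
    (eq_inv_mul_iff_mul_eq₀ hv).2 ((mul_comm _ _).trans h2.symm), (inv_mul_cancel₀ hv).symm]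

theorem dehomogenize_smul_homogeneous {c : ℝ} (hc : c ≠ 0) (x : E2) (t : ℝ) :
    dehomogenize (c • homogeneous x t) = x := by
  ext i
  fin_cases i <;> simp [homogeneous, dehomogenize, hc]

theorem continuousOn_dehomogenize : ContinuousOn dehomogenize {v | v 3 ≠ 0} := by
  refine (PiLp.continuous_toLp 2 _).comp_continuousOn (continuousOn_pi.2 fun i => ?_)
  have h (j : Fin 4) : ContinuousOn (fun v : V4 => v j / v 3) {v | v 3 ≠ 0} :=
    (continuous_apply j).continuousOn.div (continuous_apply 3).continuousOn fun _ => id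
  fin_cases i
  exacts [h 0, h 1]

/-- The point of `E3` at height `t` over `x`. -/
def atHeight (x : E2) (t : ℝ) : E3 := !₂[x 0, x 1, t]

@[simp] theorem atHeight_two (x : E2) (t : ℝ) : atHeight x t 2 = t := rfl

@[simp] theorem proj_atHeight (x : E2) (t : ℝ) : proj (atHeight x t) = x := by
  ext i; fin_cases i <;> rfl

theorem atHeight_proj (p : E3) : atHeight (proj p) (p 2) = p := by
  ext i; fin_cases i <;> rfl

theorem mem_horizontalSection {t : ℝ} {p : E3} :
    p ∈ horizontalSection 𝔹 t ↔ p 2 = t ∧ homogeneous (proj p) t ∈ cone 𝔹 := by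
  rw [← mk_mem_iff_mem_cone (homogeneous_ne_zero _ _)]
  exact and_congr_right fun h => by subst h; rfl

theorem mem_proj_image_horizontalSection {t : ℝ} {x : E2} :
    x ∈ proj '' horizontalSection 𝔹 t ↔ homogeneous x t ∈ cone 𝔹 := by
  constructor
  · rintro ⟨p, hp, rfl⟩
    exact (mem_horizontalSection.1 hp).2
  · intro h
    exact ⟨atHeight x t, mem_horizontalSection.2 ⟨rfl, by simpa using h⟩, proj_atHeight x t⟩

theorem mem_horizontalSection_iff_proj_mem {t : ℝ} {p : E3} :
    p ∈ horizontalSection 𝔹 t ↔ p 2 = t ∧ proj p ∈ proj '' horizontalSection 𝔹 t := by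
  rw [mem_horizontalSection, mem_proj_image_horizontalSection]

end Cone

namespace IsConvexConcave

variable {𝔹 : Set RP3}

theorem apply_three_ne_zero (h𝔹 : IsConvexConcave infiniteLine 𝔹) {t : ℝ} {v : V4}
    (hv : v ∈ cone 𝔹) (hvt : v ∈ levelPlane t) : v 3 ≠ 0 := by
  intro h3
  obtain ⟨hv0, hv⟩ := hv
  refine Set.disjoint_left.1 h𝔹.disjoint hv ((mk_mem_projPoints_iff hv0).2 ⟨?_, h3⟩)
  rw [mem_levelPlane.1 hvt, h3, mul_zero]

theorem homogeneous_dehomogenize_mem_cone (h𝔹 : IsConvexConcave infiniteLine 𝔹) {t : ℝ} {v : V4}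
    (hv : v ∈ cone 𝔹) (hvt : v ∈ levelPlane t) : homogeneous (dehomogenize v) t ∈ cone 𝔹 := by
  have h3 := h𝔹.apply_three_ne_zero hv hvt
  rwa [homogeneous_dehomogenize hvt h3, smul_mem_cone_iff (inv_ne_zero h3)]

theorem isCompact_sphere_inter_cone (h𝔹 : IsConvexConcave infiniteLine 𝔹) (W : Submodule ℝ V4) :
    IsCompact (Metric.sphere 0 1 ∩ (cone 𝔹 ∩ W)) := by
  obtain ⟨C, hC, hCB⟩ := isClosed_induced_iff.1 h𝔹.isClosed
  have hcone : Metric.sphere 0 1 ∩ cone 𝔹 = Metric.sphere 0 1 ∩ C := by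
    ext v
    refine and_congr_right fun hv => ?_
    have hv0 : v ≠ 0 := ne_zero_of_mem_unit_sphere ⟨v, hv⟩
    exact (mk_mem_iff_mem_cone hv0).symm.trans (Set.ext_iff.1 hCB ⟨v, hv0⟩).symm
  rw [← inter_assoc, hcone, inter_assoc]
  exact (isCompact_sphere _ _).inter_right (hC.inter W.closed_of_finiteDimensional)

theorem isCompact_proj_image (h𝔹 : IsConvexConcave infiniteLine 𝔹) (t : ℝ) :
    IsCompact (proj '' horizontalSection 𝔹 t) := by
  have himage : proj '' horizontalSection 𝔹 t =
      dehomogenize '' (Metric.sphere 0 1 ∩ (cone 𝔹 ∩ levelPlane t)) := by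
    ext x
    rw [mem_proj_image_horizontalSection]
    constructor
    · intro hx
      have hc := inv_ne_zero (norm_ne_zero_iff.2 (homogeneous_ne_zero x t))
      refine ⟨‖homogeneous x t‖⁻¹ • homogeneous x t, ⟨?_, (smul_mem_cone_iff hc).2 hx,
        (levelPlane t).smul_mem _ (homogeneous_mem_levelPlane x t)⟩,
        dehomogenize_smul_homogeneous hc x t⟩
      exact mem_sphere_zero_iff_norm.2 (norm_smul_inv_norm (𝕜 := ℝ) (homogeneous_ne_zero x t))
    · rintro ⟨v, ⟨-, hv, hvt⟩, rfl⟩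
      exact h𝔹.homogeneous_dehomogenize_mem_cone hv hvt
  rw [himage]
  exact (h𝔹.isCompact_sphere_inter_cone _).image_of_continuousOn <|
    continuousOn_dehomogenize.mono fun v ⟨_, hv, hvt⟩ => h𝔹.apply_three_ne_zero hv hvt

theorem convex_proj_image (h𝔹 : IsConvexConcave infiniteLine 𝔹) (t : ℝ) :
    Convex ℝ (proj '' horizontalSection 𝔹 t) := by
  have hconvex := h𝔹.convex (levelPlane t) (finrank_levelPlane t) (infiniteLine_le_levelPlane t)
    (LinearMap.proj 3) (fun v hv => hv.2)
  intro x hx y hy a b ha hb hab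
  rw [mem_proj_image_horizontalSection] at hx hy ⊢
  have hcomb : homogeneous (a • x + b • y) t = a • homogeneous x t + b • homogeneous y t := by
    ext i
    fin_cases i <;> simp [homogeneous, ← add_mul, hab]
  rw [hcomb]
  exact (hconvex ⟨homogeneous_mem_levelPlane x t, by simp [homogeneous], hx⟩
    ⟨homogeneous_mem_levelPlane y t, by simp [homogeneous], hy⟩ ha hb hab).2.2

end IsConvexConcave

theorem linearIndependent_homogeneous {r s : ℝ} (hrs : r ≠ s) (x y : E2) :
    LinearIndependent ℝ ![homogeneous x r, homogeneous y s] := by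
  rw [LinearIndependent.pair_iff]
  intro α β h
  have h2 : α * r + β * s = 0 := by simpa [homogeneous] using congrFun h 2
  have h3 : α + β = 0 := by simpa [homogeneous] using congrFun h 3
  have hα : α = 0 := by
    refine (mul_eq_zero.1 ?_).resolve_right (sub_ne_zero.2 hrs)
    linear_combination h2 - s * h3
  exact ⟨hα, by simpa [hα] using h3⟩

theorem span_pair_eq_of_finrank_eq_two {k V : Type*} [DivisionRing k] [AddCommGroup V] [Module k V]
    {l : Submodule k V} (hl : finrank k l = 2) {v w : V} (hv : v ∈ l) (hw : w ∈ l)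
    (hvw : LinearIndependent k ![v, w]) : Submodule.span k {v, w} = l := by
  have : FiniteDimensional k l := .of_finrank_pos (by lia)
  refine Submodule.eq_of_le_of_finrank_eq (Submodule.span_le.2 (pair_subset hv hw)) ?_
  rw [← Matrix.range_cons_cons_empty v w, finrank_span_eq_card hvw, Fintype.card_fin, hl]

theorem exists_affineMap_of_homogeneous_mem {l : Submodule ℝ V4} (hl : finrank ℝ l = 2)
    {r s t : ℝ} (hrs : r ≠ s) {x y z : E2} (hx : homogeneous x r ∈ l) (hy : homogeneous y s ∈ l)
    (hz : homogeneous z t ∈ l) : ∃ g : ℝ →ᵃ[ℝ] E2, g r = x ∧ g s = y ∧ g t = z := by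
  rw [← span_pair_eq_of_finrank_eq_two hl hx hy (linearIndependent_homogeneous hrs x y),
    Submodule.mem_span_pair] at hz
  obtain ⟨α, β, h⟩ := hz
  have h0 : α * x 0 + β * y 0 = z 0 := by simpa [homogeneous] using congrFun h 0
  have h1 : α * x 1 + β * y 1 = z 1 := by simpa [homogeneous] using congrFun h 1
  have h2 : α * r + β * s = t := by simpa [homogeneous] using congrFun h 2
  have h3 : α + β = 1 := by simpa [homogeneous] using congrFun h 3
  refine ⟨interpolant r s x y, interpolant_left .., interpolant_right hrs .., ?_⟩
  have hβ : (s - r)⁻¹ * (t - r) = β := by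
    rw [inv_mul_eq_iff_eq_mul₀ (sub_ne_zero.2 hrs.symm)]
    linear_combination r * h3 - h2
  rw [interpolant_apply, hβ, AffineMap.lineMap_apply_module, ← h3, add_sub_cancel_right]
  ext i
  fin_cases i
  exacts [h0, h1]

theorem IsConvexConcave.isConvexConcaveFamily {𝔹 : Set RP3}
    (h𝔹 : IsConvexConcave infiniteLine 𝔹) :
    IsConvexConcaveFamily fun t => proj '' horizontalSection 𝔹 t where
  isCompact := h𝔹.isCompact_proj_image
  convex := h𝔹.convex_proj_image
  exists_line := by
    intro r s t hrs hrt hst x hx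
    rw [mem_proj_image_horizontalSection] at hx
    obtain ⟨l, hl, hxl, hs, ht⟩ := h𝔹.lines
      (levelPlane r) (levelPlane s) (levelPlane t)
      (finrank_levelPlane r) (finrank_levelPlane s) (finrank_levelPlane t)
      (infiniteLine_le_levelPlane r) (infiniteLine_le_levelPlane s) (infiniteLine_le_levelPlane t)
      (levelPlane_injective.ne hrs) (levelPlane_injective.ne hrt) (levelPlane_injective.ne hst)
      _ ⟨(mk_mem_iff_mem_cone (homogeneous_ne_zero x r)).2 hx,
        (mk_mem_projPoints_iff _).2 (homogeneous_mem_levelPlane x r)⟩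
    have hpoint {s : ℝ} (hs : (projPoints l ∩ (𝔹 ∩ projPoints (levelPlane s))).Nonempty) :
        ∃ y ∈ proj '' horizontalSection 𝔹 s, homogeneous y s ∈ l := by
      obtain ⟨v, hv, hvl, hvs⟩ := exists_mem_cone_of_mem hs
      refine ⟨dehomogenize v, mem_proj_image_horizontalSection.2
        (h𝔹.homogeneous_dehomogenize_mem_cone hv hvs), ?_⟩
      rw [homogeneous_dehomogenize hvs (h𝔹.apply_three_ne_zero hv hvs)]
      exact l.smul_mem _ hvl
    obtain ⟨y, hy, hyl⟩ := hpoint hs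
    obtain ⟨z, hz, hzl⟩ := hpoint ht
    obtain ⟨g, hgx, rfl, rfl⟩ := exists_affineMap_of_homogeneous_mem hl hrs
      ((mk_mem_projPoints_iff _).1 hxl) hyl hzl
    exact ⟨g, hgx, hy, hz⟩

/-! ### Half-planes and sectors -/

section HalfSpace

variable {E : Type*} [NormedAddCommGroup E] [InnerProductSpace ℝ E] {u : E}

theorem isOpenMap_inner (hu : u ≠ 0) : IsOpenMap (innerSL ℝ u) := by
  refine (innerSL ℝ u).isOpenMap_of_ne_zero fun h => hu ?_
  rw [← inner_self_eq_zero (𝕜 := ℝ)]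
  exact DFunLike.congr_fun h u

theorem interior_setOf_inner_nonneg (hu : u ≠ 0) :
    interior {x | 0 ≤ ⟪u, x⟫_ℝ} = {x | 0 < ⟪u, x⟫_ℝ} := by
  change interior (innerSL ℝ u ⁻¹' Ici 0) = innerSL ℝ u ⁻¹' Ioi 0
  rw [← (isOpenMap_inner hu).preimage_interior_eq_interior_preimage (innerSL ℝ u).continuous,
    interior_Ici]

theorem frontier_setOf_inner_nonneg (hu : u ≠ 0) :
    frontier {x | 0 ≤ ⟪u, x⟫_ℝ} = {x | ⟪u, x⟫_ℝ = 0} := by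
  change frontier (innerSL ℝ u ⁻¹' Ici 0) = innerSL ℝ u ⁻¹' {0}
  rw [← (isOpenMap_inner hu).preimage_frontier_eq_frontier_preimage (innerSL ℝ u).continuous,
    frontier_Ici]

theorem closure_compl_setOf_inner_nonneg (hu : u ≠ 0) :
    closure {x | 0 ≤ ⟪u, x⟫_ℝ}ᶜ = {x | ⟪u, x⟫_ℝ ≤ 0} := by
  change closure (innerSL ℝ u ⁻¹' Ici 0)ᶜ = innerSL ℝ u ⁻¹' Iic 0
  rw [← preimage_compl, compl_Ici,
    ← (isOpenMap_inner hu).preimage_closure_eq_closure_preimage (innerSL ℝ u).continuous,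
    closure_Iio]

end HalfSpace

section HalfPlane

variable {u x : E2} {t : ℝ} {p : E3}

theorem proj_image_halfPlane (u : E2) (t : ℝ) : proj '' halfPlane u t = {x | 0 ≤ ⟪u, x⟫_ℝ} := by
  ext x
  constructor
  · rintro ⟨p, hp, rfl⟩
    exact hp.2
  · exact fun hx => ⟨atHeight x t, ⟨rfl, by simpa using hx⟩, proj_atHeight x t⟩

theorem mem_proj_image_halfPlane : x ∈ proj '' halfPlane u t ↔ 0 ≤ ⟪u, x⟫_ℝ := by
  rw [proj_image_halfPlane, mem_ofPred_eq]

theorem mem_interior_proj_image_halfPlane (hu : u ≠ 0) :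
    x ∈ interior (proj '' halfPlane u t) ↔ 0 < ⟪u, x⟫_ℝ := by
  rw [proj_image_halfPlane, interior_setOf_inner_nonneg hu, mem_ofPred_eq]

theorem mem_frontier_proj_image_halfPlane (hu : u ≠ 0) :
    x ∈ frontier (proj '' halfPlane u t) ↔ ⟪u, x⟫_ℝ = 0 := by
  rw [proj_image_halfPlane, frontier_setOf_inner_nonneg hu, mem_ofPred_eq]

theorem mem_projCompl_halfPlane (hu : u ≠ 0) :
    x ∈ projCompl (halfPlane u t) ↔ ⟪u, x⟫_ℝ ≤ 0 := by
  rw [projCompl, proj_image_halfPlane, closure_compl_setOf_inner_nonneg hu, mem_ofPred_eq]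

theorem mem_halfSpace_halfPlane : p ∈ halfSpace (halfPlane u t) ↔ 0 ≤ ⟪u, proj p⟫_ℝ :=
  mem_proj_image_halfPlane

/-- The projection along the `z`-axis as a continuous linear map. -/
def projL : E3 →L[ℝ] E2 where
  toFun := proj
  map_add' p q := by ext i; fin_cases i <;> rfl
  map_smul' c p := by ext i; fin_cases i <;> rfl
  cont := (PiLp.continuous_toLp 2 _).comp <| continuous_pi fun i => by
    fin_cases i
    exacts [PiLp.continuous_apply 2 _ 0, PiLp.continuous_apply 2 _ 1]

theorem mem_halfSpaceCompl_halfPlane (hu : u ≠ 0) :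
    p ∈ halfSpaceCompl (halfPlane u t) ↔ ⟪u, proj p⟫_ℝ ≤ 0 := by
  have hopen : IsOpenMap projL := projL.isOpenMap fun x => ⟨atHeight x 0, proj_atHeight x 0⟩
  rw [← mem_projCompl_halfPlane hu (t := t)]
  exact Set.ext_iff.1 (hopen.preimage_closure_eq_closure_preimage projL.continuous
    (proj '' halfPlane u t)ᶜ).symm p

end HalfPlane

section Sectors

variable {E : Type*} [NormedAddCommGroup E] [InnerProductSpace ℝ E] {u v w u₁ u₂ u₃ u₄ : E}

/-- The two combinatorial conditions of the theorem in terms of the inner normals `uᵢ` of the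
half-planes. -/
structure SectorConditions (u₁ u₂ u₃ u₄ : E) : Prop where
  two_nonpos : ∀ x, 0 ≤ ⟪u₁, x⟫_ℝ → ⟪u₄, x⟫_ℝ ≤ 0 → ⟪u₂, x⟫_ℝ ≤ 0
  four_nonpos : ∀ x, 0 ≤ ⟪u₃, x⟫_ℝ → 0 ≤ ⟪u₂, x⟫_ℝ → ⟪u₄, x⟫_ℝ ≤ 0

/-- The strict form of `SectorConditions`, valid for pairwise independent normals: away from the
apex, the sectors `{0 ≤ u₁, u₄ ≤ 0}` and `{0 ≤ u₂, 0 ≤ u₃}` lie in the open sectors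
`{u₂ < 0, 0 < u₃}` and `{u₁ < 0, u₄ < 0}`. -/
structure StrictSectorConditions (u₁ u₂ u₃ u₄ : E) : Prop where
  two_neg_three_pos : ∀ {x}, 0 ≤ ⟪u₁, x⟫_ℝ → ⟪u₄, x⟫_ℝ ≤ 0 → 0 < ⟪u₁, x⟫_ℝ ∨ ⟪u₄, x⟫_ℝ < 0 →
    ⟪u₂, x⟫_ℝ < 0 ∧ 0 < ⟪u₃, x⟫_ℝ
  one_neg_four_neg : ∀ {x}, 0 ≤ ⟪u₂, x⟫_ℝ → 0 ≤ ⟪u₃, x⟫_ℝ → 0 < ⟪u₂, x⟫_ℝ ∨ 0 < ⟪u₃, x⟫_ℝ →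
    ⟪u₁, x⟫_ℝ < 0 ∧ ⟪u₄, x⟫_ℝ < 0

theorem exists_inner_eq_zero_inner_eq_one (huv : LinearIndependent ℝ ![u, v]) :
    ∃ e, ⟪u, e⟫_ℝ = 0 ∧ ⟪v, e⟫_ℝ = 1 := by
  have hu : ⟪u, u⟫_ℝ ≠ 0 := inner_self_ne_zero.2 (huv.ne_zero 0)
  have hne : v - (⟪u, v⟫_ℝ / ⟪u, u⟫_ℝ) • u ≠ 0 := fun h => by
    have := LinearIndependent.pair_iff.1 huv (-(⟪u, v⟫_ℝ / ⟪u, u⟫_ℝ)) 1 (by rw [← h]; module)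
    exact one_ne_zero this.2
  set e := v - (⟪u, v⟫_ℝ / ⟪u, u⟫_ℝ) • u with he
  have hue : ⟪u, e⟫_ℝ = 0 := by
    rw [he, inner_sub_right, inner_smul_right, div_mul_cancel₀ _ hu, sub_self]
  have hve : ⟪v, e⟫_ℝ = ⟪e, e⟫_ℝ := by
    conv_rhs => rw [he]
    rw [inner_sub_left, real_inner_smul_left, hue, mul_zero, sub_zero]
  refine ⟨(⟪e, e⟫_ℝ)⁻¹ • e, by rw [inner_smul_right, hue, mul_zero], ?_⟩
  rw [inner_smul_right, hve, inv_mul_cancel₀ (inner_self_ne_zero.2 hne)]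

/- If `w` vanished at `x`, then `w` would be positive at a nearby point of the sector, obtained by
moving `x` along the boundary `u = 0`. -/
theorem inner_neg_of_sector (huw : LinearIndependent ℝ ![u, w])
    (h : ∀ x, 0 ≤ ⟪u, x⟫_ℝ → 0 ≤ ⟪v, x⟫_ℝ → ⟪w, x⟫_ℝ ≤ 0) {x : E} (hux : 0 ≤ ⟪u, x⟫_ℝ)
    (hvx : 0 < ⟪v, x⟫_ℝ) : ⟪w, x⟫_ℝ < 0 := by
  obtain ⟨e, hue, hwe⟩ := exists_inner_eq_zero_inner_eq_one huw
  obtain ⟨ε, hε, hεv⟩ := exists_pos_mul_lt hvx (-⟪v, e⟫_ℝ)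
  have hw := h (x + ε • e) (by rwa [inner_add_right, inner_smul_right, hue, mul_zero, add_zero])
    (by rw [inner_add_right, inner_smul_right]; linarith)
  rw [inner_add_right, inner_smul_right, hwe] at hw
  linarith

theorem SectorConditions.strict (h : SectorConditions u₁ u₂ u₃ u₄)
    (h₁₂ : LinearIndependent ℝ ![u₁, u₂]) (h₂₄ : LinearIndependent ℝ ![u₂, u₄])
    (h₃₄ : LinearIndependent ℝ ![u₃, u₄]) : StrictSectorConditions u₁ u₂ u₃ u₄ := by
  have h₄₂ : LinearIndependent ℝ ![-u₄, u₂] :=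
    LinearIndependent.pair_neg_left_iff.2 (LinearIndependent.pair_symm_iff.1 h₂₄)
  have htwo : ∀ x, 0 ≤ ⟪u₁, x⟫_ℝ → 0 ≤ ⟪-u₄, x⟫_ℝ → ⟪u₂, x⟫_ℝ ≤ 0 := fun x h₁ h₄ =>
    h.two_nonpos x h₁ (by rwa [inner_neg_left, neg_nonneg] at h₄)
  have two_neg {x : E} (hx₁ : 0 ≤ ⟪u₁, x⟫_ℝ) (hx₄ : ⟪u₄, x⟫_ℝ ≤ 0)
      (hx : 0 < ⟪u₁, x⟫_ℝ ∨ ⟪u₄, x⟫_ℝ < 0) : ⟪u₂, x⟫_ℝ < 0 := by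
    rw [← neg_nonneg, ← inner_neg_left] at hx₄
    rw [← neg_pos (a := ⟪u₄, x⟫_ℝ), ← inner_neg_left] at hx
    exact hx.elim (inner_neg_of_sector h₄₂ (fun y h₄ h₁ => htwo y h₁ h₄) hx₄)
      (inner_neg_of_sector h₁₂ htwo hx₁)
  have four_neg {x : E} (hx₂ : 0 ≤ ⟪u₂, x⟫_ℝ) (hx₃ : 0 ≤ ⟪u₃, x⟫_ℝ)
      (hx : 0 < ⟪u₂, x⟫_ℝ ∨ 0 < ⟪u₃, x⟫_ℝ) : ⟪u₄, x⟫_ℝ < 0 :=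
    hx.elim (inner_neg_of_sector h₃₄ h.four_nonpos hx₃)
      (inner_neg_of_sector h₂₄ (fun y h₂ h₃ => h.four_nonpos y h₃ h₂) hx₂)
  constructor
  · intro x hx₁ hx₄ hx
    have hx₂ := two_neg hx₁ hx₄ hx
    refine ⟨hx₂, ?_⟩
    by_contra! hx₃
    have := four_neg (x := -x) (by simpa using hx₂.le) (by simpa using hx₃) (by simp [hx₂])
    rw [inner_neg_right] at this
    linarith
  · intro x hx₂ hx₃ hx
    have hx₄ := four_neg hx₂ hx₃ hx
    refine ⟨?_, hx₄⟩
    by_contra! hx₁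
    exact (two_neg hx₁ hx₄.le (.inr hx₄)).not_ge hx₂

end Sectors

theorem sectorConditions_iff {u₁ u₂ u₃ u₄ : E2} (hu₂ : u₂ ≠ 0) (hu₄ : u₄ ≠ 0) (t₁ t₂ t₃ t₄ : ℝ) :
    (proj '' halfPlane u₁ t₁ ∩ projCompl (halfPlane u₄ t₄) ⊆ projCompl (halfPlane u₂ t₂) ∧
      proj '' halfPlane u₃ t₃ ∩ proj '' halfPlane u₂ t₂ ⊆ projCompl (halfPlane u₄ t₄)) ↔
    SectorConditions u₁ u₂ u₃ u₄ := by
  simp only [subset_def, mem_inter_iff, mem_projCompl_halfPlane hu₂, mem_projCompl_halfPlane hu₄,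
    mem_proj_image_halfPlane, and_imp]
  exact ⟨fun ⟨h, h'⟩ => ⟨h, h'⟩, fun ⟨h, h'⟩ => ⟨h, h'⟩⟩

/-! ### Crossing angles and codes -/

section RelativeSlope

variable {E : Type*} [NormedAddCommGroup E] [InnerProductSpace ℝ E] {p q u v u₁ u₂ u₃ u₄ : E}

/-- The number `σ` with `⟪u, q⟫ = σ * ⟪u, p⟫`. For a base point `p` and the direction of motion `q`,
the line orthogonal to `u` is spanned by `q - σ • p`, so that boundary lines are met in the order of
increasing `σ`. -/
noncomputable def relativeSlope (p q u : E) : ℝ := ⟪u, q⟫_ℝ / ⟪u, p⟫_ℝ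

theorem relativeSlope_neg (p q u : E) : relativeSlope p (-q) u = -relativeSlope p q u := by
  rw [relativeSlope, inner_neg_right, neg_div, relativeSlope]

theorem inner_smul_add_smul (hu : ⟪u, p⟫_ℝ ≠ 0) (α β : ℝ) :
    ⟪u, α • p + β • q⟫_ℝ = ⟪u, p⟫_ℝ * (α + β * relativeSlope p q u) := by
  rw [inner_add_right, inner_smul_right, inner_smul_right, relativeSlope]
  field_simp

theorem inner_smul_add_smul_nonneg_iff_of_pos (hu : 0 < ⟪u, p⟫_ℝ) {α β : ℝ} :
    0 ≤ ⟪u, α • p + β • q⟫_ℝ ↔ 0 ≤ α + β * relativeSlope p q u := by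
  rw [inner_smul_add_smul hu.ne', mul_nonneg_iff_of_pos_left hu]

theorem inner_smul_add_smul_nonneg_iff_of_neg (hu : ⟪u, p⟫_ℝ < 0) {α β : ℝ} :
    0 ≤ ⟪u, α • p + β • q⟫_ℝ ↔ α + β * relativeSlope p q u ≤ 0 := by
  rw [inner_smul_add_smul hu.ne]
  exact ⟨fun h => nonpos_of_mul_nonneg_right h hu, mul_nonneg_of_nonpos_of_nonpos hu.le⟩

theorem inner_smul_add_smul_nonpos_iff_of_neg (hu : ⟪u, p⟫_ℝ < 0) {α β : ℝ} :
    ⟪u, α • p + β • q⟫_ℝ ≤ 0 ↔ 0 ≤ α + β * relativeSlope p q u := by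
  rw [inner_smul_add_smul hu.ne]
  exact ⟨fun h => nonneg_of_mul_nonpos_right h hu, mul_nonpos_of_nonpos_of_nonneg hu.le⟩

theorem relativeSlope_ne_of_linearIndependent (hpq : ∀ x : E, ∃ α β : ℝ, x = α • p + β • q)
    (huv : LinearIndependent ℝ ![u, v]) (hu : ⟪u, p⟫_ℝ ≠ 0) (hv : ⟪v, p⟫_ℝ ≠ 0) :
    relativeSlope p q u ≠ relativeSlope p q v := by
  intro heq
  obtain ⟨e, hue, hve⟩ := exists_inner_eq_zero_inner_eq_one huv
  obtain ⟨α, β, rfl⟩ := hpq e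
  rw [inner_smul_add_smul hu, mul_eq_zero, or_iff_right hu, heq] at hue
  rw [inner_smul_add_smul hv, hue, mul_zero] at hve
  exact zero_ne_one hve

theorem sectorConditions_of_relativeSlope_lt (hpq : ∀ x : E, ∃ α β : ℝ, x = α • p + β • q)
    (h₁ : 0 < ⟪u₁, p⟫_ℝ) (h₂ : ⟪u₂, p⟫_ℝ < 0) (h₃ : 0 < ⟪u₃, p⟫_ℝ) (h₄ : ⟪u₄, p⟫_ℝ < 0)
    (h₁₂ : relativeSlope p q u₁ < relativeSlope p q u₂)
    (h₂₃ : relativeSlope p q u₂ < relativeSlope p q u₃)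
    (h₃₄ : relativeSlope p q u₃ < relativeSlope p q u₄) : SectorConditions u₁ u₂ u₃ u₄ := by
  constructor <;> intro x <;> obtain ⟨α, β, rfl⟩ := hpq x
  · rw [inner_smul_add_smul_nonneg_iff_of_pos h₁, inner_smul_add_smul_nonpos_iff_of_neg h₂,
      inner_smul_add_smul_nonpos_iff_of_neg h₄]
    intro hx₁ hx₄
    rcases le_total 0 β with hβ | hβ
    · linarith [mul_nonneg hβ (sub_nonneg.2 h₁₂.le)]
    · linarith [mul_nonneg_of_nonpos_of_nonpos hβ (sub_nonpos.2 (h₂₃.trans h₃₄).le)]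
  · rw [inner_smul_add_smul_nonneg_iff_of_neg h₂, inner_smul_add_smul_nonneg_iff_of_pos h₃,
      inner_smul_add_smul_nonpos_iff_of_neg h₄]
    intro hx₃ hx₂
    have hβ : 0 ≤ β := by
      by_contra! hβ
      linarith [mul_neg_of_neg_of_pos hβ (sub_pos.2 h₂₃)]
    linarith [mul_nonneg hβ (sub_nonneg.2 h₃₄.le)]

/- Each inequality is a sector condition at a vector `±(q - σ • p)` spanning a boundary line. -/
theorem SectorConditions.relativeSlope_le (h : SectorConditions u₁ u₂ u₃ u₄)
    (h₁ : 0 < ⟪u₁, p⟫_ℝ) (h₂ : ⟪u₂, p⟫_ℝ < 0) (h₃ : 0 < ⟪u₃, p⟫_ℝ) (h₄ : ⟪u₄, p⟫_ℝ < 0)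
    (h₂₄ : relativeSlope p q u₂ ≠ relativeSlope p q u₄)
    (h₁₄ : relativeSlope p q u₁ < relativeSlope p q u₄) :
    relativeSlope p q u₁ ≤ relativeSlope p q u₂ ∧ relativeSlope p q u₂ ≤ relativeSlope p q u₃ ∧
      relativeSlope p q u₃ ≤ relativeSlope p q u₄ := by
  have two {α β : ℝ} := h.two_nonpos (α • p + β • q)
  have four {α β : ℝ} := h.four_nonpos (α • p + β • q)
  simp only [inner_smul_add_smul_nonneg_iff_of_pos h₁, inner_smul_add_smul_nonpos_iff_of_neg h₂,
    inner_smul_add_smul_nonpos_iff_of_neg h₄] at two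
  simp only [inner_smul_add_smul_nonneg_iff_of_pos h₃, inner_smul_add_smul_nonneg_iff_of_neg h₂,
    inner_smul_add_smul_nonpos_iff_of_neg h₄] at four
  have le₁₂ : relativeSlope p q u₁ ≤ relativeSlope p q u₂ := by
    linarith [two (α := -relativeSlope p q u₁) (β := 1) (by linarith) (by linarith)]
  have lt₂₄ : relativeSlope p q u₂ < relativeSlope p q u₄ := by
    refine lt_of_le_of_ne ?_ h₂₄
    linarith [two (α := relativeSlope p q u₄) (β := -1) (by linarith) (by linarith)]
  have le₂₃ : relativeSlope p q u₂ ≤ relativeSlope p q u₃ := by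
    by_contra! hlt
    linarith [four (α := relativeSlope p q u₃) (β := -1) (by linarith) (by linarith)]
  refine ⟨le₁₂, le₂₃, ?_⟩
  linarith [four (α := -relativeSlope p q u₃) (β := 1) (by linarith) (by linarith)]

end RelativeSlope

section Circle

/-- The unit vector in the direction of motion at `circlePoint φ`, for the orientation `ε = ±1` of
the circle. -/
noncomputable def circleTangent (φ ε : ℝ) : E2 := ε • circlePoint (φ + Real.pi / 2)

theorem circleTangent_neg (φ ε : ℝ) : circleTangent φ (-ε) = -circleTangent φ ε := neg_smul _ _

theorem circlePoint_add {ε : ℝ} (hε : ε = 1 ∨ ε = -1) (φ θ : ℝ) :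
    circlePoint (φ + ε * θ) = Real.cos θ • circlePoint φ + Real.sin θ • circleTangent φ ε := by
  have hcos : Real.cos (ε * θ) = Real.cos θ := by rcases hε with rfl | rfl <;> simp
  have hsin : Real.sin (ε * θ) = ε * Real.sin θ := by rcases hε with rfl | rfl <;> simp
  ext i
  fin_cases i
  · change Real.cos (φ + ε * θ) =
      Real.cos θ * Real.cos φ + Real.sin θ * (ε * Real.cos (φ + Real.pi / 2))
    rw [Real.cos_add, hcos, hsin, Real.cos_add_pi_div_two]
    ring
  · change Real.sin (φ + ε * θ) =
      Real.cos θ * Real.sin φ + Real.sin θ * (ε * Real.sin (φ + Real.pi / 2))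
    rw [Real.sin_add, hcos, hsin, Real.sin_add_pi_div_two]
    ring

theorem exists_eq_norm_smul_circlePoint (x : E2) : ∃ ψ, x = ‖x‖ • circlePoint ψ := by
  let z : ℂ := ⟨x 0, x 1⟩
  have hnorm : ‖x‖ = ‖z‖ := by
    rw [EuclideanSpace.norm_eq, Complex.norm_eq_sqrt_sq_add_sq, Fin.sum_univ_two]
    simp [z]
  refine ⟨z.arg, ?_⟩
  rw [hnorm]
  ext i
  fin_cases i
  exacts [z.norm_mul_cos_arg.symm, z.norm_mul_sin_arg.symm]

theorem exists_eq_smul_circlePoint_add_smul_circleTangent {ε : ℝ} (hε : ε = 1 ∨ ε = -1) (φ : ℝ)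
    (x : E2) : ∃ α β : ℝ, x = α • circlePoint φ + β • circleTangent φ ε := by
  obtain ⟨ψ, hψ⟩ := exists_eq_norm_smul_circlePoint x
  have hangle : ψ = φ + ε * (ε * (ψ - φ)) := by rcases hε with rfl | rfl <;> ring
  rw [hangle, circlePoint_add hε, smul_add, smul_smul, smul_smul] at hψ
  exact ⟨_, _, hψ⟩

/-- The angle in `(0, π)` at which the line orthogonal to `u` is met on the way around the circle
from `circlePoint φ` with orientation `ε`. -/
noncomputable def crossingAngle (φ ε : ℝ) (u : E2) : ℝ :=
  Real.arctan (relativeSlope (circlePoint φ) (circleTangent φ ε) u) + Real.pi / 2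

theorem crossingAngle_pos (φ ε : ℝ) (u : E2) : 0 < crossingAngle φ ε u :=
  neg_lt_iff_pos_add.1 (Real.neg_pi_div_two_lt_arctan _)

theorem crossingAngle_lt_pi (φ ε : ℝ) (u : E2) : crossingAngle φ ε u < Real.pi := by
  rw [crossingAngle, ← lt_sub_iff_add_lt, sub_half]
  exact Real.arctan_lt_pi_div_two _

theorem crossingAngle_lt_crossingAngle {φ ε : ℝ} {u v : E2} :
    crossingAngle φ ε u < crossingAngle φ ε v ↔
      relativeSlope (circlePoint φ) (circleTangent φ ε) u <
        relativeSlope (circlePoint φ) (circleTangent φ ε) v := by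
  rw [crossingAngle, crossingAngle, add_lt_add_iff_right, Real.arctan_strictMono.lt_iff_lt]

theorem inner_circlePoint_eq_zero_iff {φ ε θ : ℝ} (hε : ε = 1 ∨ ε = -1) {u : E2}
    (hu : ⟪u, circlePoint φ⟫_ℝ ≠ 0) (hθ : 0 < θ) (hθ' : θ < Real.pi) :
    ⟪u, circlePoint (φ + ε * θ)⟫_ℝ = 0 ↔ θ = crossingAngle φ ε u := by
  have htan : ⟪u, circlePoint (φ + ε * θ)⟫_ℝ = 0 ↔ Real.tan (θ - Real.pi / 2) =
      relativeSlope (circlePoint φ) (circleTangent φ ε) u := by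
    rw [circlePoint_add hε, inner_smul_add_smul hu, mul_eq_zero, or_iff_right hu,
      Real.tan_eq_sin_div_cos, Real.sin_sub_pi_div_two, Real.cos_sub_pi_div_two,
      div_eq_iff (Real.sin_pos_of_pos_of_lt_pi hθ hθ').ne', neg_eq_iff_add_eq_zero, mul_comm]
  rw [htan, crossingAngle, ← sub_eq_iff_eq_add]
  constructor
  · intro h
    rw [← h, Real.arctan_tan (by linarith) (by linarith)]
  · intro h
    rw [h, Real.tan_arctan]

end Circle

theorem exists_pairwise_lt_sublist {ι β : Type*} [Finite ι] [LinearOrder β] {θ : ι → β}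
    (hθ : Function.Injective θ) {l : List ι} (hl : l.Pairwise (θ · < θ ·)) :
    ∃ s : List ι, l.Sublist s ∧ (∀ i, i ∈ s) ∧ s.Pairwise (θ · < θ ·) := by
  have := Fintype.ofFinite ι
  let _ : LinearOrder ι := .lift' θ hθ
  have hs : (Finset.univ.sort).Pairwise (θ · < θ ·) := (Finset.sortedLT_sort _).pairwise
  have hmem (i : ι) : i ∈ Finset.univ.sort := (Finset.mem_sort _).2 (Finset.mem_univ i)
  have hnodup : l.Nodup := hl.imp fun h => ne_of_apply_ne θ h.ne
  exact ⟨_, List.sublist_of_subperm_of_pairwise (r := (· < ·))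
    (List.subperm_of_subset hnodup fun i _ => hmem i) hl hs, hmem, hs⟩

theorem exists_mem_sector_forall_inner_ne_zero {E ι : Type*} [NormedAddCommGroup E]
    [InnerProductSpace ℝ E] [CompleteSpace E] [Countable ι] {u : ι → E} (hu : ∀ i, u i ≠ 0)
    {v w : E} (hvw : LinearIndependent ℝ ![v, w]) :
    ∃ x, 0 < ⟪v, x⟫_ℝ ∧ ⟪w, x⟫_ℝ < 0 ∧ ∀ i, ⟪u i, x⟫_ℝ ≠ 0 := by
  have hopen (i : ι) : IsOpen {x | ⟪u i, x⟫_ℝ ≠ 0} :=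
    isOpen_compl_singleton.preimage (innerSL ℝ (u i)).continuous
  have hdense (i : ι) : Dense {x | ⟪u i, x⟫_ℝ ≠ 0} :=
    (dense_compl_singleton (0 : ℝ)).preimage (isOpenMap_inner (hu i))
  have hsector : IsOpen {x | 0 < ⟪v, x⟫_ℝ ∧ ⟪w, x⟫_ℝ < 0} :=
    (isOpen_Ioi.preimage (innerSL ℝ v).continuous).inter
      (isOpen_Iio.preimage (innerSL ℝ w).continuous)
  obtain ⟨e, hwe, hve⟩ :=
    exists_inner_eq_zero_inner_eq_one (LinearIndependent.pair_symm_iff.1 hvw)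
  obtain ⟨f, hvf, hwf⟩ := exists_inner_eq_zero_inner_eq_one hvw
  have hne : {x | 0 < ⟪v, x⟫_ℝ ∧ ⟪w, x⟫_ℝ < 0}.Nonempty :=
    ⟨e - f, by simp [inner_sub_right, hve, hvf, hwe, hwf]⟩
  obtain ⟨x, ⟨hvx, hwx⟩, hux⟩ :=
    (dense_iInter_of_isOpen hopen hdense).inter_open_nonempty _ hsector hne
  exact ⟨x, hvx, hwx, mem_iInter.1 hux⟩

theorem ne_zero_of_pairwise_linearIndependent {k V ι : Type*} [Semiring k] [Nontrivial k]
    [AddCommMonoid V] [Module k V] [Nontrivial ι] {u : ι → V}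
    (hu : ∀ i j, i ≠ j → LinearIndependent k ![u i, u j]) (i : ι) : u i ≠ 0 := by
  obtain ⟨j, hj⟩ := exists_ne i
  exact (hu i j hj.symm).ne_zero 0

section Code

variable {m : ℕ} {u : Fin m → E2} {φ ε : ℝ}

theorem sectorConditions_of_isCode (hu : ∀ i, u i ≠ 0) {c : List (Fin m × Bool)}
    (hc : IsCode (fun i => {x | 0 ≤ ⟪u i, x⟫_ℝ}) φ ε c) {i₁ i₂ i₃ i₄ : Fin m}
    (hsub : [(i₁, true), (i₂, false), (i₃, true), (i₄, false)].Sublist c) :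
    SectorConditions (u i₁) (u i₂) (u i₃) (u i₄) := by
  have hbase (i : Fin m) : ⟪u i, circlePoint φ⟫_ℝ ≠ 0 := fun h =>
    hc.base i (by rwa [frontier_setOf_inner_nonneg (hu i)])
  have hpos {i : Fin m} (hi : (i, true) ∈ c) : 0 < ⟪u i, circlePoint φ⟫_ℝ :=
    lt_of_le_of_ne ((hc.sign _ hi).1 rfl) (hbase i).symm
  have hneg {i : Fin m} (hi : (i, false) ∈ c) : ⟪u i, circlePoint φ⟫_ℝ < 0 :=
    not_le.1 fun h => Bool.false_ne_true ((hc.sign _ hi).2 h)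
  obtain ⟨θ, hθ, horder⟩ := hc.order
  have hcrossing (i : Fin m) : θ i = crossingAngle φ ε (u i) := by
    obtain ⟨hθpos, hθpi, hmem⟩ := hθ i
    rw [frontier_setOf_inner_nonneg (hu i)] at hmem
    exact (inner_circlePoint_eq_zero_iff hc.orientation (hbase i) hθpos hθpi).1 hmem
  simp only [hcrossing, crossingAngle_lt_crossingAngle] at horder
  have hpairwise := horder.sublist hsub
  simp only [List.pairwise_cons, List.mem_cons, forall_eq_or_imp] at hpairwise
  have hmem := hsub.subset
  simp only [List.cons_subset] at hmem
  exact sectorConditions_of_relativeSlope_lt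
    (exists_eq_smul_circlePoint_add_smul_circleTangent hc.orientation φ)
    (hpos hmem.1) (hneg hmem.2.1) (hpos hmem.2.2.1) (hneg hmem.2.2.2.1)
    hpairwise.1.1 hpairwise.2.1.1 hpairwise.2.2.1.1

theorem exists_isCode_of_forall_inner_ne_zero (hu : ∀ i j, i ≠ j → LinearIndependent ℝ ![u i, u j])
    (hu₀ : ∀ i, u i ≠ 0) (hε : ε = 1 ∨ ε = -1) (hφ : ∀ i, ⟪u i, circlePoint φ⟫_ℝ ≠ 0)
    {l : List (Fin m)}
    (hl : l.Pairwise fun i j => crossingAngle φ ε (u i) < crossingAngle φ ε (u j)) :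
    ∃ c, IsCode (fun i => {x | 0 ≤ ⟪u i, x⟫_ℝ}) φ ε c ∧
      (l.map fun i => (i, decide (0 < ⟪u i, circlePoint φ⟫_ℝ))).Sublist c := by
  have hinj : Function.Injective fun i => crossingAngle φ ε (u i) := by
    intro i j hij
    by_contra hne
    refine relativeSlope_ne_of_linearIndependent
      (exists_eq_smul_circlePoint_add_smul_circleTangent hε φ) (hu i j hne) (hφ i) (hφ j) ?_
    exact Real.arctan_injective (add_right_cancel hij)
  obtain ⟨s, hls, hmem, hs⟩ := exists_pairwise_lt_sublist hinj hl
  refine ⟨s.map fun i => (i, decide (0 < ⟪u i, circlePoint φ⟫_ℝ)),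
    { orientation := hε, base := ?_, all := ?_, order := ⟨_, fun i =>
        ⟨crossingAngle_pos φ ε (u i), crossingAngle_lt_pi φ ε (u i), ?_⟩, List.pairwise_map.2 hs⟩,
      sign := ?_ }, hls.map _⟩
  · intro i
    rw [frontier_setOf_inner_nonneg (hu₀ i)]
    exact hφ i
  · simpa using hmem
  · rw [frontier_setOf_inner_nonneg (hu₀ i)]
    exact (inner_circlePoint_eq_zero_iff hε (hφ i) (crossingAngle_pos ..)
      (crossingAngle_lt_pi ..)).2 rfl
  · intro a ha
    obtain ⟨i, -, rfl⟩ := List.mem_map.1 ha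
    rw [decide_eq_true_iff]
    exact ⟨le_of_lt, fun h => lt_of_le_of_ne h (hφ i).symm⟩

theorem exists_orientation_crossingAngle_lt {u₁ u₂ : E2} (h : LinearIndependent ℝ ![u₁, u₂])
    (h₁ : ⟪u₁, circlePoint φ⟫_ℝ ≠ 0) (h₂ : ⟪u₂, circlePoint φ⟫_ℝ ≠ 0) :
    ∃ ε : ℝ, (ε = 1 ∨ ε = -1) ∧ crossingAngle φ ε u₁ < crossingAngle φ ε u₂ := by
  simp only [crossingAngle_lt_crossingAngle]
  rcases lt_or_gt_of_ne (relativeSlope_ne_of_linearIndependent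
    (exists_eq_smul_circlePoint_add_smul_circleTangent (.inl rfl) φ) h h₁ h₂) with hlt | hgt
  · exact ⟨1, .inl rfl, hlt⟩
  · refine ⟨-1, .inr rfl, ?_⟩
    rwa [circleTangent_neg, relativeSlope_neg, relativeSlope_neg, neg_lt_neg_iff]

theorem SectorConditions.exists_isCode (hu : ∀ i j, i ≠ j → LinearIndependent ℝ ![u i, u j])
    (hu₀ : ∀ i, u i ≠ 0) {i₁ i₂ i₃ i₄ : Fin m} (h₁₂ : i₁ ≠ i₂) (h₁₄ : i₁ ≠ i₄) (h₂₃ : i₂ ≠ i₃)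
    (h₂₄ : i₂ ≠ i₄) (h₃₄ : i₃ ≠ i₄) (h : SectorConditions (u i₁) (u i₂) (u i₃) (u i₄)) :
    ∃ (φ ε : ℝ) (c : List (Fin m × Bool)), IsCode (fun i => {x | 0 ≤ ⟪u i, x⟫_ℝ}) φ ε c ∧
      [(i₁, true), (i₂, false), (i₃, true), (i₄, false)].Sublist c := by
  obtain ⟨x, hx₁, hx₄, hx⟩ := exists_mem_sector_forall_inner_ne_zero hu₀ (hu _ _ h₁₄)
  obtain ⟨φ, hφ⟩ := exists_eq_norm_smul_circlePoint x
  have hnorm : 0 < ‖x‖ := norm_pos_iff.2 fun h0 => hx i₁ (by rw [h0, inner_zero_right])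
  rw [hφ] at hx₁ hx₄ hx
  simp only [inner_smul_right, mul_ne_zero_iff_left hnorm.ne', mul_pos_iff_of_pos_left hnorm]
    at hx₁ hx₄ hx
  replace hx₄ := neg_of_mul_neg_right hx₄ hnorm.le
  obtain ⟨hx₂, hx₃⟩ := (h.strict (hu _ _ h₁₂) (hu _ _ h₂₄)
    (hu _ _ h₃₄)).two_neg_three_pos hx₁.le hx₄.le (.inl hx₁)
  obtain ⟨ε, hε, lt₁₄⟩ := exists_orientation_crossingAngle_lt (hu _ _ h₁₄) (hx i₁) (hx i₄)
  have hslope (i j : Fin m) (hij : i ≠ j) := relativeSlope_ne_of_linearIndependent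
    (exists_eq_smul_circlePoint_add_smul_circleTangent hε φ) (hu i j hij) (hx i) (hx j)
  obtain ⟨le₁₂, le₂₃, le₃₄⟩ := h.relativeSlope_le hx₁ hx₂ hx₃ hx₄ (hslope _ _ h₂₄)
    (crossingAngle_lt_crossingAngle.1 lt₁₄)
  have lt₁₂ := lt_of_le_of_ne le₁₂ (hslope _ _ h₁₂)
  have lt₂₃ := lt_of_le_of_ne le₂₃ (hslope _ _ h₂₃)
  have lt₃₄ := lt_of_le_of_ne le₃₄ (hslope _ _ h₃₄)
  obtain ⟨c, hc, hsub⟩ := exists_isCode_of_forall_inner_ne_zero hu hu₀ hε hx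
    (l := [i₁, i₂, i₃, i₄]) (by
      simp [crossingAngle_lt_crossingAngle, lt₁₂, lt₂₃, lt₃₄, lt₁₂.trans lt₂₃, lt₂₃.trans lt₃₄,
        lt₁₂.trans (lt₂₃.trans lt₃₄)])
  exact ⟨φ, ε, c, hc, by simpa [hx₁, hx₂.not_gt, hx₃, hx₄.not_gt] using hsub⟩

theorem sectorConditions_iff_exists_isCode
    (hu : ∀ i j, i ≠ j → LinearIndependent ℝ ![u i, u j]) (hu₀ : ∀ i, u i ≠ 0)
    {i₁ i₂ i₃ i₄ : Fin m} (h₁₂ : i₁ ≠ i₂) (h₁₄ : i₁ ≠ i₄) (h₂₃ : i₂ ≠ i₃)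
    (h₂₄ : i₂ ≠ i₄) (h₃₄ : i₃ ≠ i₄) :
    SectorConditions (u i₁) (u i₂) (u i₃) (u i₄) ↔
      ∃ (φ ε : ℝ) (c : List (Fin m × Bool)), IsCode (fun i => {x | 0 ≤ ⟪u i, x⟫_ℝ}) φ ε c ∧
        [(i₁, true), (i₂, false), (i₃, true), (i₄, false)].Sublist c :=
  ⟨SectorConditions.exists_isCode hu hu₀ h₁₂ h₁₄ h₂₃ h₂₄ h₃₄,
    fun ⟨_, _, _, hc, hsub⟩ => sectorConditions_of_isCode hu₀ hc hsub⟩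

end Code

/-! ### Sectorial lines -/

section Lines

variable {E : Type*} [NormedAddCommGroup E] [InnerProductSpace ℝ E] {u u₁ u₂ u₃ u₄ : E}
  {g : ℝ →ᵃ[ℝ] E}

theorem inner_affineMap_apply (u : E) (g : ℝ →ᵃ[ℝ] E) (r s : ℝ) :
    ⟪u, g s⟫_ℝ = ⟪u, g r⟫_ℝ + (s - r) * ⟪u, g.linear 1⟫_ℝ := by
  have hg : g s = (s - r) • g.linear 1 + g r := by
    rw [← map_smul, smul_eq_mul, mul_one, ← vsub_eq_sub, AffineMap.linearMap_vsub, vsub_eq_sub,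
      sub_add_cancel]
  rw [hg, inner_add_right, inner_smul_right, add_comm]

theorem strictMono_inner_of_lt {r s : ℝ} (hrs : r < s) (h : ⟪u, g r⟫_ℝ < ⟪u, g s⟫_ℝ) :
    StrictMono fun z => ⟪u, g z⟫_ℝ := by
  rw [inner_affineMap_apply u g r s, lt_add_iff_pos_right, mul_pos_iff_of_pos_left
    (sub_pos.2 hrs)] at h
  intro y z hyz
  beta_reduce
  rw [inner_affineMap_apply u g y z, lt_add_iff_pos_right]
  exact mul_pos (sub_pos.2 hyz) h

theorem strictAnti_inner_of_lt {r s : ℝ} (hrs : r < s) (h : ⟪u, g s⟫_ℝ < ⟪u, g r⟫_ℝ) :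
    StrictAnti fun z => ⟪u, g z⟫_ℝ := by
  have := strictMono_inner_of_lt (u := -u) (g := g) hrs (by simpa [inner_neg_left] using h)
  intro y z hyz
  simpa [inner_neg_left] using this hyz

/-- The line encoded by `g` meets the hyperplane orthogonal to `u` at the single parameter `z`. -/
def CrossesAt (g : ℝ →ᵃ[ℝ] E) (u : E) (z : ℝ) : Prop := ∀ s, ⟪u, g s⟫_ℝ = 0 ↔ s = z

theorem CrossesAt.inner_eq_zero {z : ℝ} (h : CrossesAt g u z) : ⟪u, g z⟫_ℝ = 0 := (h z).2 rfl

theorem CrossesAt.inner_apply {z : ℝ} (h : CrossesAt g u z) (s : ℝ) :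
    ⟪u, g s⟫_ℝ = (s - z) * ⟪u, g.linear 1⟫_ℝ := by
  rw [inner_affineMap_apply u g z, h.inner_eq_zero, zero_add]

theorem CrossesAt.inner_linear_ne_zero {z : ℝ} (h : CrossesAt g u z) :
    ⟪u, g.linear 1⟫_ℝ ≠ 0 := by
  intro h0
  have := (h (z + 1)).1 (by rw [h.inner_apply, h0, mul_zero])
  linarith

theorem CrossesAt.injective {z : ℝ} (h : CrossesAt g u z) : Function.Injective g := by
  intro r s hrs
  have heq : ⟪u, g r⟫_ℝ = ⟪u, g s⟫_ℝ := by rw [hrs]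
  rw [h.inner_apply, h.inner_apply, mul_left_inj' h.inner_linear_ne_zero] at heq
  exact sub_left_injective heq

theorem crossesAt_of_injective (hinj : Function.Injective fun s => ⟪u, g s⟫_ℝ) {z : ℝ}
    (hz : ⟪u, g z⟫_ℝ = 0) : CrossesAt g u z :=
  fun _ => ⟨fun hs => hinj (hs.trans hz.symm), fun hs => hs ▸ hz⟩

theorem exists_crossesAt_of_neg_of_pos {r s : ℝ} (hrs : r < s) (hr : ⟪u, g r⟫_ℝ < 0)
    (hs : 0 < ⟪u, g s⟫_ℝ) : ∃ z ∈ Ioo r s, CrossesAt g u z := by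
  have hcont : Continuous fun z => ⟪u, g z⟫_ℝ :=
    continuous_const.inner g.continuous_of_finiteDimensional
  obtain ⟨z, hz, hz₀⟩ := intermediate_value_Ioo hrs.le hcont.continuousOn ⟨hr, hs⟩
  exact ⟨z, hz, crossesAt_of_injective (strictMono_inner_of_lt hrs (hr.trans hs)).injective hz₀⟩

theorem exists_crossesAt_of_pos_of_neg {r s : ℝ} (hrs : r < s) (hr : 0 < ⟪u, g r⟫_ℝ)
    (hs : ⟪u, g s⟫_ℝ < 0) : ∃ z ∈ Ioo r s, CrossesAt g u z := by
  simpa [CrossesAt, inner_neg_left] using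
    exists_crossesAt_of_neg_of_pos (u := -u) (g := g) hrs (by simpa using hr) (by simpa using hs)

/-- The signs of the normals `uᵢ` along a line that meets the four half-planes at the heights `tᵢ`
in the prescribed sectors. -/
structure IsSectorialLine (u₁ u₂ u₃ u₄ : E) (t₁ t₂ t₃ t₄ : ℝ) (g : ℝ →ᵃ[ℝ] E) : Prop where
  one_pos : 0 < ⟪u₁, g t₁⟫_ℝ
  four_nonpos : ⟪u₄, g t₁⟫_ℝ ≤ 0
  two_pos : 0 < ⟪u₂, g t₂⟫_ℝ
  three_nonneg : 0 ≤ ⟪u₃, g t₂⟫_ℝ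
  three_pos : 0 < ⟪u₃, g t₃⟫_ℝ
  two_nonneg : 0 ≤ ⟪u₂, g t₃⟫_ℝ
  four_pos : 0 < ⟪u₄, g t₄⟫_ℝ
  one_nonpos : ⟪u₁, g t₄⟫_ℝ ≤ 0

/-- The boundary lines with normals `u₁, u₂, u₃, u₄` are crossed at the heights `A < B` between the
first two planes and at the heights `C < D` between the last two. -/
structure CrossesInOrder (g : ℝ →ᵃ[ℝ] E) (u₁ u₂ u₃ u₄ : E) (t₁ t₂ t₃ t₄ A B C D : ℝ) : Prop where
  one : CrossesAt g u₁ A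
  two : CrossesAt g u₂ B
  three : CrossesAt g u₃ C
  four : CrossesAt g u₄ D
  lt_one : t₁ < A
  one_lt_two : A < B
  two_lt : B < t₂
  lt_three : t₃ < C
  three_lt_four : C < D
  four_lt : D < t₄

variable {t₁ t₂ t₃ t₄ : ℝ}

theorem IsSectorialLine.exists_crossesInOrder (hg : IsSectorialLine u₁ u₂ u₃ u₄ t₁ t₂ t₃ t₄ g)
    (h : StrictSectorConditions u₁ u₂ u₃ u₄) (h₁₂ : t₁ < t₂) (h₂₃ : t₂ < t₃) (h₃₄ : t₃ < t₄) :
    ∃ A B C D, CrossesInOrder g u₁ u₂ u₃ u₄ t₁ t₂ t₃ t₄ A B C D := by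
  have two_neg := (h.two_neg_three_pos hg.one_pos.le hg.four_nonpos (.inl hg.one_pos)).1
  have one_neg := (h.one_neg_four_neg hg.two_pos.le hg.three_nonneg (.inl hg.two_pos)).1
  have four_neg := (h.one_neg_four_neg hg.two_nonneg hg.three_pos.le (.inr hg.three_pos)).2
  have two_mono : StrictMono fun s => ⟪u₂, g s⟫_ℝ :=
    strictMono_inner_of_lt h₁₂ (two_neg.trans hg.two_pos)
  have four_mono : StrictMono fun s => ⟪u₄, g s⟫_ℝ :=
    strictMono_inner_of_lt h₃₄ (four_neg.trans hg.four_pos)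
  obtain ⟨A, hA, one⟩ := exists_crossesAt_of_pos_of_neg h₁₂ hg.one_pos one_neg
  obtain ⟨B, hB, two⟩ := exists_crossesAt_of_neg_of_pos h₁₂ two_neg hg.two_pos
  obtain ⟨D, hD, four⟩ := exists_crossesAt_of_neg_of_pos h₃₄ four_neg hg.four_pos
  have two_pos_of_lt {s : ℝ} (hs : B < s) : 0 < ⟪u₂, g s⟫_ℝ :=
    two.inner_eq_zero.symm.trans_lt (two_mono hs)
  have four_neg_of_lt {s : ℝ} (hs : s < D) : ⟪u₄, g s⟫_ℝ < 0 :=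
    (four_mono hs).trans_eq four.inner_eq_zero
  have three_neg : ⟪u₃, g t₄⟫_ℝ < 0 := by
    by_contra! hnonneg
    have hpos := two_pos_of_lt (hB.2.trans (h₂₃.trans h₃₄))
    exact (h.one_neg_four_neg hpos.le hnonneg (.inl hpos)).2.not_gt hg.four_pos
  obtain ⟨C, hC, three⟩ := exists_crossesAt_of_pos_of_neg h₃₄ hg.three_pos three_neg
  have hAB : A < B := by
    have hneg := four_neg_of_lt (hA.2.trans (h₂₃.trans hD.1))
    refine two_mono.lt_iff_lt.1 ?_
    rw [two.inner_eq_zero]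
    exact (h.two_neg_three_pos one.inner_eq_zero.ge hneg.le (.inr hneg)).1
  have hCD : C < D := by
    have hpos := two_pos_of_lt (hB.2.trans (h₂₃.trans hC.1))
    refine four_mono.lt_iff_lt.1 ?_
    rw [four.inner_eq_zero]
    exact (h.one_neg_four_neg hpos.le three.inner_eq_zero.ge (.inl hpos)).2
  exact ⟨A, B, C, D, one, two, three, four, hA.1, hAB, hB.2, hC.1, hCD, hD.2⟩

theorem isSectorialLine_of_pos (h : StrictSectorConditions u₁ u₂ u₃ u₄) (h₁₂ : t₁ < t₂)
    (h₂₃ : t₂ < t₃) (h₃₄ : t₃ < t₄) (one_pos : 0 < ⟪u₁, g t₁⟫_ℝ) (two_pos : 0 < ⟪u₂, g t₂⟫_ℝ)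
    (three_pos : 0 < ⟪u₃, g t₃⟫_ℝ) (four_pos : 0 < ⟪u₄, g t₄⟫_ℝ)
    (four_nonpos : ⟪u₄, g t₁⟫_ℝ ≤ 0) (two_nonneg : 0 ≤ ⟪u₂, g t₃⟫_ℝ) :
    IsSectorialLine u₁ u₂ u₃ u₄ t₁ t₂ t₃ t₄ g := by
  have three_nonneg : 0 ≤ ⟪u₃, g t₂⟫_ℝ := by
    by_contra! hneg
    have hpos := (h.two_neg_three_pos one_pos.le four_nonpos (.inl one_pos)).2
    have three_anti := strictAnti_inner_of_lt h₁₂ (hneg.trans hpos)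
    exact ((three_anti h₂₃).trans hneg).not_gt three_pos
  have one_neg := (h.one_neg_four_neg two_nonneg three_pos.le (.inr three_pos)).1
  have one_anti := strictAnti_inner_of_lt (h₁₂.trans h₂₃) (one_neg.trans one_pos)
  exact ⟨one_pos, four_nonpos, two_pos, three_nonneg, three_pos, two_nonneg, four_pos,
    ((one_anti h₃₄).trans one_neg).le⟩

/- Signs propagate along lines of the family, so that the first and the third section, cut down to
the prescribed half-planes, still satisfy the hypotheses of `exists_affineMap_transversal`. -/
theorem IsConvexConcaveFamily.exists_isSectorialLine {S : ℝ → Set E}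
    (hS : IsConvexConcaveFamily S) (h : StrictSectorConditions u₁ u₂ u₃ u₄)
    (h₁₂ : t₁ < t₂) (h₂₃ : t₂ < t₃) (h₃₄ : t₃ < t₄)
    (hS₁ : ∀ x ∈ S t₁, 0 < ⟪u₁, x⟫_ℝ) (hS₂ : ∀ x ∈ S t₂, 0 < ⟪u₂, x⟫_ℝ)
    (hS₃ : ∀ x ∈ S t₃, 0 < ⟪u₃, x⟫_ℝ) (hS₄ : ∀ x ∈ S t₄, 0 < ⟪u₄, x⟫_ℝ)
    (hne : ∃ x ∈ S t₁, ⟪u₄, x⟫_ℝ ≤ 0) :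
    ∃ g : ℝ →ᵃ[ℝ] E, g t₁ ∈ S t₁ ∧ g t₂ ∈ S t₂ ∧ g t₃ ∈ S t₃ ∧ g t₄ ∈ S t₄ ∧
      IsSectorialLine u₁ u₂ u₃ u₄ t₁ t₂ t₃ t₄ g := by
  have h₁₃ := h₁₂.trans h₂₃
  have h₁₄ := h₁₃.trans h₃₄
  have hfwd : ∀ x ∈ S t₁ ∩ {x | ⟪u₄, x⟫_ℝ ≤ 0}, ∃ f : ℝ →ᵃ[ℝ] E,
      f t₁ = x ∧ f t₂ ∈ S t₂ ∧ f t₃ ∈ S t₃ ∩ {x | 0 ≤ ⟪u₂, x⟫_ℝ} := by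
    rintro x ⟨hx, hx₄⟩
    obtain ⟨f, rfl, mem₂, mem₃⟩ := hS.exists_line h₁₂.ne h₁₃.ne h₂₃.ne x hx
    have two_neg := (h.two_neg_three_pos (hS₁ _ hx).le hx₄ (.inl (hS₁ _ hx))).1
    have two_mono := strictMono_inner_of_lt h₁₂ (two_neg.trans (hS₂ _ mem₂))
    exact ⟨f, rfl, mem₂, mem₃, ((hS₂ _ mem₂).trans (two_mono h₂₃)).le⟩
  have hbwd : ∀ x ∈ S t₃ ∩ {x | 0 ≤ ⟪u₂, x⟫_ℝ}, ∃ f : ℝ →ᵃ[ℝ] E,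
      f t₃ = x ∧ f t₁ ∈ S t₁ ∩ {x | ⟪u₄, x⟫_ℝ ≤ 0} ∧ f t₄ ∈ S t₄ := by
    rintro x ⟨hx, hx₂⟩
    obtain ⟨f, rfl, mem₁, mem₄⟩ := hS.exists_line h₁₃.ne' h₃₄.ne h₁₄.ne x hx
    have four_neg := (h.one_neg_four_neg hx₂ (hS₃ _ hx).le (.inr (hS₃ _ hx))).2
    have four_mono := strictMono_inner_of_lt h₃₄ (four_neg.trans (hS₄ _ mem₄))
    exact ⟨f, rfl, ⟨mem₁, ((four_mono h₁₃).trans four_neg).le⟩, mem₄⟩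
  obtain ⟨g, ⟨mem₁, four_nonpos⟩, mem₂, ⟨mem₃, two_nonneg⟩, mem₄⟩ := exists_affineMap_transversal
    h₁₃.ne
    ((hS.isCompact t₁).inter_right (isClosed_Iic.preimage (innerSL ℝ u₄).continuous))
    (hS.isCompact t₂).isClosed
    ((hS.isCompact t₃).inter_right (isClosed_Ici.preimage (innerSL ℝ u₂).continuous))
    (hS.isCompact t₄).isClosed
    ((hS.convex t₁).inter ((convex_Iic (0 : ℝ)).linear_preimage (innerSL ℝ u₄).toLinearMap))
    (hS.convex t₂)
    ((hS.convex t₃).inter ((convex_Ici (0 : ℝ)).linear_preimage (innerSL ℝ u₂).toLinearMap))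
    (hS.convex t₄) hne hfwd hbwd
  exact ⟨g, mem₁, mem₂, mem₃, mem₄, isSectorialLine_of_pos h h₁₂ h₂₃ h₃₄ (hS₁ _ mem₁) (hS₂ _ mem₂)
    (hS₃ _ mem₃) (hS₄ _ mem₄) four_nonpos two_nonneg⟩

end Lines

/-! ### Double ratios along a line -/

theorem heightRatio_eq_mul (s₁ s₂ s₃ s₄ : ℝ) : heightRatio s₁ s₂ s₃ s₄ =
    (s₂ - s₁) / (s₃ - s₁) * ((s₄ - s₃) / (s₄ - s₂)) := by
  rw [heightRatio, div_div_div_eq, div_mul_div_comm, mul_comm (s₄ - s₂)]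

theorem sub_div_sub_lt_sub_div_sub {t₁ t₂ t₃ A B C : ℝ} (hA : t₁ ≤ A) (hAB : A < B) (hB : B ≤ t₂)
    (h₂₃ : t₂ ≤ t₃) (hC : t₃ < C) : (B - A) / (C - A) < (t₂ - t₁) / (t₃ - t₁) :=
  calc (B - A) / (C - A) < (B - A) / (t₃ - A) :=
      div_lt_div_of_pos_left (by linarith) (by linarith) (by linarith)
    _ ≤ (t₂ - A) / (t₃ - A) := div_le_div_of_nonneg_right (by linarith) (by linarith)
    _ ≤ (t₂ - t₁) / (t₃ - t₁) := by
      rw [div_le_div_iff₀ (by linarith) (by linarith)]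
      linarith [mul_nonneg (sub_nonneg.2 hA) (sub_nonneg.2 h₂₃)]

theorem heightRatio_lt_heightRatio {t₁ t₂ t₃ t₄ A B C D : ℝ} (hA : t₁ ≤ A) (hAB : A < B)
    (hB : B < t₂) (h₂₃ : t₂ ≤ t₃) (hC : t₃ < C) (hCD : C < D) (hD : D ≤ t₄) :
    heightRatio A B C D < heightRatio t₁ t₂ t₃ t₄ := by
  have hleft := sub_div_sub_lt_sub_div_sub hA hAB hB.le h₂₃ hC
  have hright := sub_div_sub_lt_sub_div_sub (neg_le_neg hD) (neg_lt_neg hCD) (neg_le_neg hC.le)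
    (neg_le_neg h₂₃) (neg_lt_neg hB)
  simp only [neg_sub_neg] at hright
  rw [heightRatio_eq_mul, heightRatio_eq_mul]
  exact mul_lt_mul'' hleft hright (div_nonneg (by linarith) (by linarith))
    (div_nonneg (by linarith) (by linarith))

theorem dist_affineMap_apply {E : Type*} [SeminormedAddCommGroup E] [NormedSpace ℝ E]
    (g : ℝ →ᵃ[ℝ] E) (r s : ℝ) : dist (g r) (g s) = |s - r| * ‖g.linear 1‖ := by
  rw [dist_comm, dist_eq_norm_vsub E, ← AffineMap.linearMap_vsub, vsub_eq_sub,
    ← mul_one (s - r), ← smul_eq_mul, map_smul, norm_smul, Real.norm_eq_abs, smul_eq_mul, mul_one]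

theorem doubleRatio_affineMap_apply {g : ℝ →ᵃ[ℝ] E2} (hg : g.linear 1 ≠ 0) {s₁ s₂ s₃ s₄ : ℝ}
    (h₁₂ : s₁ < s₂) (h₂₃ : s₂ < s₃) (h₃₄ : s₃ < s₄) :
    doubleRatio (g s₁) (g s₂) (g s₃) (g s₄) = heightRatio s₁ s₂ s₃ s₄ := by
  have hdist {r s : ℝ} (hrs : r < s) : dist (g r) (g s) = (s - r) * ‖g.linear 1‖ := by
    rw [dist_affineMap_apply, abs_of_pos (sub_pos.2 hrs)]
  have hnorm : ‖g.linear 1‖ ≠ 0 := norm_ne_zero_iff.2 hg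
  rw [doubleRatio, hdist h₁₂, hdist (h₂₃.trans h₃₄), hdist (h₁₂.trans h₂₃), hdist h₃₄,
    mul_div_mul_right _ _ hnorm, mul_div_mul_right _ _ hnorm, heightRatio]

theorem det2_boundaryDir (u v : E2) : det2 (boundaryDir u) (boundaryDir v) = det2 u v := by
  change -u 1 * v 0 - u 0 * -v 1 = u 0 * v 1 - u 1 * v 0
  ring

theorem det2_mul_det2 (u v a b : E2) :
    det2 u v * det2 a b = ⟪u, a⟫_ℝ * ⟪v, b⟫_ℝ - ⟪u, b⟫_ℝ * ⟪v, a⟫_ℝ := by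
  simp only [det2, PiLp.inner_apply, Fin.sum_univ_two, RCLike.inner_apply, conj_trivial]
  ring

theorem CrossesAt.det2_mul_det2_eq {g : ℝ →ᵃ[ℝ] E2} {u v : E2} {y z : ℝ} (hu : CrossesAt g u y)
    (hv : CrossesAt g v z) : det2 u v * det2 (g 0) (g.linear 1) =
      ⟪u, g.linear 1⟫_ℝ * ⟪v, g.linear 1⟫_ℝ * (z - y) := by
  rw [det2_mul_det2, hu.inner_apply, hv.inner_apply]
  ring

/- By the Lagrange identity, `det2 uᵢ uⱼ` is the difference of the two crossing parameters up to
factors that cancel in the double ratio. -/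
theorem directionRatio_boundaryDir_eq_heightRatio {g : ℝ →ᵃ[ℝ] E2} {u₁ u₂ u₃ u₄ : E2}
    {A B C D : ℝ} (h₁ : CrossesAt g u₁ A) (h₂ : CrossesAt g u₂ B) (h₃ : CrossesAt g u₃ C)
    (h₄ : CrossesAt g u₄ D) (hAB : A ≠ B) :
    directionRatio (boundaryDir u₁) (boundaryDir u₂) (boundaryDir u₃) (boundaryDir u₄) =
      heightRatio A B C D := by
  have hdet : det2 (g 0) (g.linear 1) ≠ 0 := fun h => by
    have := h₁.det2_mul_det2_eq h₂
    rw [h, mul_zero, eq_comm, mul_eq_zero, mul_eq_zero, sub_eq_zero] at this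
    simp [h₁.inner_linear_ne_zero, h₂.inner_linear_ne_zero, hAB.symm] at this
  have hdiv {u v : E2} {y z : ℝ} (hu : CrossesAt g u y) (hv : CrossesAt g v z) :
      det2 u v = ⟪u, g.linear 1⟫_ℝ * ⟪v, g.linear 1⟫_ℝ * (z - y) / det2 (g 0) (g.linear 1) :=
    eq_div_of_mul_eq hdet (hu.det2_mul_det2_eq hv)
  have := h₁.inner_linear_ne_zero
  have := h₂.inner_linear_ne_zero
  have := h₃.inner_linear_ne_zero
  have := h₄.inner_linear_ne_zero
  simp only [directionRatio, det2_boundaryDir, hdiv h₁ h₂, hdiv h₂ h₄, hdiv h₁ h₃, hdiv h₃ h₄,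
    heightRatio_eq_mul, div_div_div_cancel_right₀ hdet]
  field_simp

namespace CrossesInOrder

variable {g : ℝ →ᵃ[ℝ] E2} {u₁ u₂ u₃ u₄ : E2} {t₁ t₂ t₃ t₄ A B C D : ℝ}

theorem linear_one_ne_zero (h : CrossesInOrder g u₁ u₂ u₃ u₄ t₁ t₂ t₃ t₄ A B C D) :
    g.linear 1 ≠ 0 := fun h0 => h.one.inner_linear_ne_zero (by rw [h0, inner_zero_right])

theorem two_lt_three (h : CrossesInOrder g u₁ u₂ u₃ u₄ t₁ t₂ t₃ t₄ A B C D) (h₂₃ : t₂ ≤ t₃) :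
    B < C := h.two_lt.trans_le (h₂₃.trans h.lt_three.le)

theorem nodup (h : CrossesInOrder g u₁ u₂ u₃ u₄ t₁ t₂ t₃ t₄ A B C D) (h₂₃ : t₂ ≤ t₃) :
    [g A, g B, g C, g D].Nodup := by
  have hBC := h.two_lt_three h₂₃
  have hsorted : [A, B, C, D].SortedLT := by
    simp [List.sortedLT_iff_pairwise, h.one_lt_two, h.three_lt_four, hBC, h.one_lt_two.trans hBC,
      hBC.trans h.three_lt_four, (h.one_lt_two.trans hBC).trans h.three_lt_four]
  exact hsorted.nodup.map h.one.injective

theorem doubleRatio_eq_directionRatio (h : CrossesInOrder g u₁ u₂ u₃ u₄ t₁ t₂ t₃ t₄ A B C D)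
    (h₂₃ : t₂ ≤ t₃) : doubleRatio (g A) (g B) (g C) (g D) =
      directionRatio (boundaryDir u₁) (boundaryDir u₂) (boundaryDir u₃) (boundaryDir u₄) := by
  rw [directionRatio_boundaryDir_eq_heightRatio h.one h.two h.three h.four h.one_lt_two.ne,
    doubleRatio_affineMap_apply h.linear_one_ne_zero h.one_lt_two (h.two_lt_three h₂₃)
      h.three_lt_four]

theorem directionRatio_lt_heightRatio (h : CrossesInOrder g u₁ u₂ u₃ u₄ t₁ t₂ t₃ t₄ A B C D)
    (h₂₃ : t₂ ≤ t₃) :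
    directionRatio (boundaryDir u₁) (boundaryDir u₂) (boundaryDir u₃) (boundaryDir u₄) <
      heightRatio t₁ t₂ t₃ t₄ := by
  rw [directionRatio_boundaryDir_eq_heightRatio h.one h.two h.three h.four h.one_lt_two.ne]
  exact heightRatio_lt_heightRatio h.lt_one.le h.one_lt_two h.two_lt h₂₃ h.lt_three
    h.three_lt_four h.four_lt.le

end CrossesInOrder

/-! ### Lines in space -/

theorem affineSpan_pair_eq_of_finrank_direction_eq_one {k V P : Type*} [DivisionRing k]
    [AddCommGroup V] [Module k V] [AddTorsor V P] {l : AffineSubspace k P}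
    (hl : finrank k l.direction = 1) {p q : P} (hp : p ∈ l) (hq : q ∈ l) (hpq : p ≠ q) :
    line[k, p, q] = l := by
  have : FiniteDimensional k l.direction := .of_finrank_pos (by lia)
  have hle : affineSpan k (range ![p, q]) ≤ l := by
    rw [Matrix.range_cons_cons_empty]
    exact affineSpan_pair_le_of_mem_of_mem hp hq
  rw [← (affineIndependent_of_ne k hpq).affineSpan_eq_of_le_of_card_eq_finrank_add_one hle
    (by simp [hl]), Matrix.range_cons_cons_empty]

theorem finrank_direction_affineSpan_pair {k V P : Type*} [DivisionRing k] [AddCommGroup V]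
    [Module k V] [AddTorsor V P] {p q : P} (hpq : p ≠ q) :
    finrank k line[k, p, q].direction = 1 := by
  rw [direction_affineSpan, vectorSpan_pair, finrank_span_singleton (vsub_ne_zero.2 hpq)]

/-- The line of `E3` that passes over `g s` at height `s` for every `s`. -/
noncomputable def graphLine (g : ℝ →ᵃ[ℝ] E2) : AffineSubspace ℝ E3 :=
  line[ℝ, atHeight (g 0) 0, atHeight (g 1) 1]

section GraphLine

variable {g : ℝ →ᵃ[ℝ] E2}

theorem mem_graphLine {p : E3} : p ∈ graphLine g ↔ proj p = g (p 2) := by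
  have hlineMap (s : ℝ) : AffineMap.lineMap (atHeight (g 0) 0) (atHeight (g 1) 1) s =
      atHeight (g s) s := by
    have hg : g s = AffineMap.lineMap (g 0) (g 1) s := by
      rw [← AffineMap.apply_lineMap, AffineMap.lineMap_apply_ring']
      simp
    rw [hg]
    ext i
    fin_cases i <;> simp [AffineMap.lineMap_apply, atHeight]
  constructor
  · intro hp
    obtain ⟨s, rfl⟩ := mem_affineSpan_pair_iff_exists_lineMap_eq.1 hp
    rw [hlineMap, proj_atHeight, atHeight_two]
  · intro hp
    refine mem_affineSpan_pair_iff_exists_lineMap_eq.2 ⟨p 2, ?_⟩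
    rw [hlineMap, ← hp, atHeight_proj]

theorem atHeight_mem_graphLine (g : ℝ →ᵃ[ℝ] E2) (s : ℝ) : atHeight (g s) s ∈ graphLine g :=
  mem_graphLine.2 (proj_atHeight _ _)

theorem finrank_direction_graphLine (g : ℝ →ᵃ[ℝ] E2) : finrank ℝ (graphLine g).direction = 1 :=
  finrank_direction_affineSpan_pair fun h => by simpa using congrArg (fun p : E3 => p 2) h

theorem exists_eq_graphLine {l : AffineSubspace ℝ E3} (hl : finrank ℝ l.direction = 1) {p q : E3}
    (hp : p ∈ l) (hq : q ∈ l) (hpq : p 2 ≠ q 2) : ∃ g, l = graphLine g := by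
  have hne : p ≠ q := fun h => hpq (h ▸ rfl)
  refine ⟨interpolant (p 2) (q 2) (proj p) (proj q), ?_⟩
  rw [← affineSpan_pair_eq_of_finrank_direction_eq_one hl hp hq hne]
  refine affineSpan_pair_eq_of_finrank_direction_eq_one (finrank_direction_graphLine _) ?_ ?_ hne
  · rw [mem_graphLine, interpolant_left]
  · rw [mem_graphLine, interpolant_right hpq]

theorem proj_image_graphLine (g : ℝ →ᵃ[ℝ] E2) : proj '' graphLine g = range g := by
  ext x
  constructor
  · rintro ⟨p, hp, rfl⟩
    exact ⟨p 2, (mem_graphLine.1 hp).symm⟩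
  · rintro ⟨s, rfl⟩
    exact ⟨_, atHeight_mem_graphLine g s, proj_atHeight _ _⟩

theorem CrossesAt.proj_image_graphLine_inter_frontier {u : E2} {z : ℝ} (h : CrossesAt g u z)
    (hu : u ≠ 0) (t : ℝ) :
    proj '' graphLine g ∩ frontier (proj '' halfPlane u t) = {g z} := by
  ext x
  rw [proj_image_graphLine, mem_inter_iff, mem_frontier_proj_image_halfPlane hu, mem_singleton_iff]
  constructor
  · rintro ⟨⟨s, rfl⟩, hs⟩
    rw [(h s).1 hs]
  · rintro rfl
    exact ⟨mem_range_self z, h.inner_eq_zero⟩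

variable {𝔹 : Set RP3} {u u₁ u₂ u₃ u₄ : E2} {t t₁ t₂ t₃ t₄ : ℝ} {p p₁ p₂ p₃ p₄ : E3}

theorem proj_eq_of_mem_graphLine_of_mem_horizontalSection (hp : p ∈ graphLine g)
    (hs : p ∈ horizontalSection 𝔹 t) : proj p = g t := by
  rw [mem_graphLine.1 hp, hs.1]

theorem atHeight_mem_horizontalSection {x : E2} (hx : x ∈ proj '' horizontalSection 𝔹 t) :
    atHeight x t ∈ horizontalSection 𝔹 t :=
  mem_horizontalSection_iff_proj_mem.2 ⟨rfl, by rwa [proj_atHeight]⟩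

theorem graphLine_inter_halfSpace_nonempty (hg : g t ∈ proj '' horizontalSection 𝔹 t)
    (hu : 0 ≤ ⟪u, g t⟫_ℝ) (s : ℝ) :
    ((graphLine g : Set E3) ∩ (horizontalSection 𝔹 t ∩ halfSpace (halfPlane u s))).Nonempty :=
  ⟨_, atHeight_mem_graphLine g t, atHeight_mem_horizontalSection hg,
    mem_halfSpace_halfPlane.2 (by rwa [proj_atHeight])⟩

theorem graphLine_inter_halfSpaceCompl_nonempty (hg : g t ∈ proj '' horizontalSection 𝔹 t)
    (hu : u ≠ 0) (hu' : ⟪u, g t⟫_ℝ ≤ 0) (s : ℝ) :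
    ((graphLine g : Set E3) ∩ (horizontalSection 𝔹 t ∩ halfSpaceCompl (halfPlane u s))).Nonempty :=
  ⟨_, atHeight_mem_graphLine g t, atHeight_mem_horizontalSection hg,
    (mem_halfSpaceCompl_halfPlane hu).2 (by rwa [proj_atHeight])⟩

theorem exists_isSectorialLine_eq_graphLine (hu₁ : u₁ ≠ 0) (hu₄ : u₄ ≠ 0) (h₁₂ : t₁ ≠ t₂)
    (hS₁ : ∀ x ∈ proj '' horizontalSection 𝔹 t₁, 0 < ⟪u₁, x⟫_ℝ)
    (hS₂ : ∀ x ∈ proj '' horizontalSection 𝔹 t₂, 0 < ⟪u₂, x⟫_ℝ)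
    (hS₃ : ∀ x ∈ proj '' horizontalSection 𝔹 t₃, 0 < ⟪u₃, x⟫_ℝ)
    (hS₄ : ∀ x ∈ proj '' horizontalSection 𝔹 t₄, 0 < ⟪u₄, x⟫_ℝ)
    {l : AffineSubspace ℝ E3} (hl : finrank ℝ l.direction = 1) {s₁ s₂ s₃ s₄ : ℝ}
    (hp₁ : p₁ ∈ (l : Set E3) ∩ (horizontalSection 𝔹 t₁ ∩ halfSpaceCompl (halfPlane u₄ s₄)))
    (hp₂ : p₂ ∈ (l : Set E3) ∩ (horizontalSection 𝔹 t₂ ∩ halfSpace (halfPlane u₃ s₃)))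
    (hp₃ : p₃ ∈ (l : Set E3) ∩ (horizontalSection 𝔹 t₃ ∩ halfSpace (halfPlane u₂ s₂)))
    (hp₄ : p₄ ∈ (l : Set E3) ∩ (horizontalSection 𝔹 t₄ ∩ halfSpaceCompl (halfPlane u₁ s₁))) :
    ∃ g, l = graphLine g ∧ proj p₁ = g t₁ ∧ proj p₂ = g t₂ ∧ proj p₃ = g t₃ ∧ proj p₄ = g t₄ ∧
      IsSectorialLine u₁ u₂ u₃ u₄ t₁ t₂ t₃ t₄ g := by
  obtain ⟨hl₁, hs₁, hh₁⟩ := hp₁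
  obtain ⟨hl₂, hs₂, hh₂⟩ := hp₂
  obtain ⟨hl₃, hs₃, hh₃⟩ := hp₃
  obtain ⟨hl₄, hs₄, hh₄⟩ := hp₄
  obtain ⟨g, rfl⟩ := exists_eq_graphLine hl hl₁ hl₂ (by rwa [hs₁.1, hs₂.1])
  have eq₁ := proj_eq_of_mem_graphLine_of_mem_horizontalSection hl₁ hs₁
  have eq₂ := proj_eq_of_mem_graphLine_of_mem_horizontalSection hl₂ hs₂
  have eq₃ := proj_eq_of_mem_graphLine_of_mem_horizontalSection hl₃ hs₃
  have eq₄ := proj_eq_of_mem_graphLine_of_mem_horizontalSection hl₄ hs₄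
  refine ⟨g, rfl, eq₁, eq₂, eq₃, eq₄, ?_⟩
  rw [mem_halfSpaceCompl_halfPlane hu₄, eq₁] at hh₁
  rw [mem_halfSpace_halfPlane, eq₂] at hh₂
  rw [mem_halfSpace_halfPlane, eq₃] at hh₃
  rw [mem_halfSpaceCompl_halfPlane hu₁, eq₄] at hh₄
  exact ⟨hS₁ _ ⟨p₁, hs₁, eq₁⟩, hh₁, hS₂ _ ⟨p₂, hs₂, eq₂⟩, hh₂, hS₃ _ ⟨p₃, hs₃, eq₃⟩, hh₃,
    hS₄ _ ⟨p₄, hs₄, eq₄⟩, hh₄⟩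

namespace IsSectorialLine

theorem inter_nonempty (hg : IsSectorialLine u₁ u₂ u₃ u₄ t₁ t₂ t₃ t₄ g) (hu₁ : u₁ ≠ 0)
    (hu₄ : u₄ ≠ 0) (s₁ s₂ s₃ s₄ : ℝ) (hg₁ : g t₁ ∈ proj '' horizontalSection 𝔹 t₁)
    (hg₂ : g t₂ ∈ proj '' horizontalSection 𝔹 t₂) (hg₃ : g t₃ ∈ proj '' horizontalSection 𝔹 t₃)
    (hg₄ : g t₄ ∈ proj '' horizontalSection 𝔹 t₄) :
    (proj '' horizontalSection 𝔹 t₂ ∩ proj '' halfPlane u₃ s₃).Nonempty ∧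
    (proj '' horizontalSection 𝔹 t₃ ∩ proj '' halfPlane u₂ s₂).Nonempty ∧
    (proj '' horizontalSection 𝔹 t₄ ∩ projCompl (halfPlane u₁ s₁)).Nonempty ∧
    ∃ l : AffineSubspace ℝ E3, finrank ℝ l.direction = 1 ∧
      ((l : Set E3) ∩ (horizontalSection 𝔹 t₁ ∩ halfSpaceCompl (halfPlane u₄ s₄))).Nonempty ∧
      ((l : Set E3) ∩ (horizontalSection 𝔹 t₂ ∩ halfSpace (halfPlane u₃ s₃))).Nonempty ∧
      ((l : Set E3) ∩ (horizontalSection 𝔹 t₃ ∩ halfSpace (halfPlane u₂ s₂))).Nonempty ∧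
      ((l : Set E3) ∩ (horizontalSection 𝔹 t₄ ∩ halfSpaceCompl (halfPlane u₁ s₁))).Nonempty :=
  ⟨⟨_, hg₂, mem_proj_image_halfPlane.2 hg.three_nonneg⟩,
    ⟨_, hg₃, mem_proj_image_halfPlane.2 hg.two_nonneg⟩,
    ⟨_, hg₄, (mem_projCompl_halfPlane hu₁).2 hg.one_nonpos⟩,
    graphLine g, finrank_direction_graphLine g,
    graphLine_inter_halfSpaceCompl_nonempty hg₁ hu₄ hg.four_nonpos s₄,
    graphLine_inter_halfSpace_nonempty hg₂ hg.three_nonneg s₃,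
    graphLine_inter_halfSpace_nonempty hg₃ hg.two_nonneg s₂,
    graphLine_inter_halfSpaceCompl_nonempty hg₄ hu₁ hg.one_nonpos s₁⟩

theorem exists_inter_frontier_eq_singleton_and_doubleRatio_eq
    (hg : IsSectorialLine u₁ u₂ u₃ u₄ t₁ t₂ t₃ t₄ g) (h : StrictSectorConditions u₁ u₂ u₃ u₄)
    (h₁₂ : t₁ < t₂) (h₂₃ : t₂ < t₃) (h₃₄ : t₃ < t₄) (hu₁ : u₁ ≠ 0) (hu₂ : u₂ ≠ 0) (hu₃ : u₃ ≠ 0)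
    (hu₄ : u₄ ≠ 0) (s₁ s₂ s₃ s₄ : ℝ) :
    ∃ A B C D : E2,
      proj '' graphLine g ∩ frontier (proj '' halfPlane u₁ s₁) = {A} ∧
      proj '' graphLine g ∩ frontier (proj '' halfPlane u₂ s₂) = {B} ∧
      proj '' graphLine g ∩ frontier (proj '' halfPlane u₃ s₃) = {C} ∧
      proj '' graphLine g ∩ frontier (proj '' halfPlane u₄ s₄) = {D} ∧
      [A, B, C, D].Nodup ∧
      doubleRatio A B C D =
        directionRatio (boundaryDir u₁) (boundaryDir u₂) (boundaryDir u₃) (boundaryDir u₄) ∧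
      doubleRatio (g t₁) (g t₂) (g t₃) (g t₄) = heightRatio t₁ t₂ t₃ t₄ := by
  obtain ⟨A, B, C, D, hcross⟩ := hg.exists_crossesInOrder h h₁₂ h₂₃ h₃₄
  exact ⟨g A, g B, g C, g D,
    hcross.one.proj_image_graphLine_inter_frontier hu₁ s₁,
    hcross.two.proj_image_graphLine_inter_frontier hu₂ s₂,
    hcross.three.proj_image_graphLine_inter_frontier hu₃ s₃,
    hcross.four.proj_image_graphLine_inter_frontier hu₄ s₄,
    hcross.nodup h₂₃.le, hcross.doubleRatio_eq_directionRatio h₂₃.le,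
    doubleRatio_affineMap_apply hcross.linear_one_ne_zero h₁₂ h₂₃ h₃₄⟩

end IsSectorialLine

end GraphLine

end SectorialBrowder

theorem mainTheorem5
    (𝔹 : Set RP3) (h𝔹 : IsConvexConcave infiniteLine 𝔹)
    {m : ℕ} (t : Fin m → ℝ) (ht : StrictMono t)
    (u : Fin m → E2) (hu : ∀ i j, i ≠ j → LinearIndependent ℝ ![u i, u j])
    (S H : Fin m → Set E3)
    (hS : ∀ i, S i = horizontalSection 𝔹 (t i))
    (hH : ∀ i, H i = halfPlane (u i) (t i))
    (hSH : ∀ i, proj '' S i ⊆ interior (proj '' H i))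
    (i₁ i₂ i₃ i₄ : Fin m) (h₁₂ : i₁ < i₂) (h₂₃ : i₂ < i₃) (h₃₄ : i₃ < i₄) :
    -- the two combinatorial conditions in terms of codes
    ((proj '' H i₁ ∩ projCompl (H i₄) ⊆ projCompl (H i₂) ∧
        proj '' H i₃ ∩ proj '' H i₂ ⊆ projCompl (H i₄)) ↔
      ∃ (φ ε : ℝ) (c : List (Fin m × Bool)),
        IsCode (fun i => proj '' H i) φ ε c ∧
        [(i₁, true), (i₂, false), (i₃, true), (i₄, false)].Sublist c) ∧
    (proj '' H i₁ ∩ projCompl (H i₄) ⊆ projCompl (H i₂) →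
      proj '' H i₃ ∩ proj '' H i₂ ⊆ projCompl (H i₄) →
      (proj '' S i₁ ∩ projCompl (H i₄)).Nonempty →
      (proj '' S i₂ ∩ proj '' H i₃).Nonempty ∧
      (proj '' S i₃ ∩ proj '' H i₂).Nonempty ∧
      (proj '' S i₄ ∩ projCompl (H i₁)).Nonempty ∧
      -- the line
      (∃ l : AffineSubspace ℝ E3, finrank ℝ l.direction = 1 ∧
        ((l : Set E3) ∩ (S i₁ ∩ halfSpaceCompl (H i₄))).Nonempty ∧
        ((l : Set E3) ∩ (S i₂ ∩ halfSpace (H i₃))).Nonempty ∧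
        ((l : Set E3) ∩ (S i₃ ∩ halfSpace (H i₂))).Nonempty ∧
        ((l : Set E3) ∩ (S i₄ ∩ halfSpaceCompl (H i₁))).Nonempty) ∧
      -- the two double ratios, read off any such line
      (∀ l : AffineSubspace ℝ E3, finrank ℝ l.direction = 1 →
        ∀ p₁ ∈ (l : Set E3) ∩ (S i₁ ∩ halfSpaceCompl (H i₄)),
        ∀ p₂ ∈ (l : Set E3) ∩ (S i₂ ∩ halfSpace (H i₃)),
        ∀ p₃ ∈ (l : Set E3) ∩ (S i₃ ∩ halfSpace (H i₂)),
        ∀ p₄ ∈ (l : Set E3) ∩ (S i₄ ∩ halfSpaceCompl (H i₁)),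
        ∃ A B C D : E2,
          proj '' l ∩ frontier (proj '' H i₁) = {A} ∧
          proj '' l ∩ frontier (proj '' H i₂) = {B} ∧
          proj '' l ∩ frontier (proj '' H i₃) = {C} ∧
          proj '' l ∩ frontier (proj '' H i₄) = {D} ∧
          [A, B, C, D].Nodup ∧
          doubleRatio A B C D =
            directionRatio (boundaryDir (u i₁)) (boundaryDir (u i₂))
              (boundaryDir (u i₃)) (boundaryDir (u i₄)) ∧
          doubleRatio (proj p₁) (proj p₂) (proj p₃) (proj p₄) =
            heightRatio (t i₁) (t i₂) (t i₃) (t i₄)) ∧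
      -- the inequality between the double ratios
      directionRatio (boundaryDir (u i₁)) (boundaryDir (u i₂))
          (boundaryDir (u i₃)) (boundaryDir (u i₄)) <
        heightRatio (t i₁) (t i₂) (t i₃) (t i₄)) := by
  obtain rfl : S = fun i => horizontalSection 𝔹 (t i) := funext hS
  obtain rfl : H = fun i => halfPlane (u i) (t i) := funext hH
  have : Nontrivial (Fin m) := ⟨i₁, i₂, h₁₂.ne⟩
  have hu₀ := ne_zero_of_pairwise_linearIndependent hu
  have hpos : ∀ i, ∀ x ∈ proj '' horizontalSection 𝔹 (t i), 0 < ⟪u i, x⟫_ℝ := fun i x hx =>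
    (mem_interior_proj_image_halfPlane (hu₀ i)).1 (hSH i hx)
  have hsector := sectorConditions_iff (u₁ := u i₁) (u₃ := u i₃) (hu₀ i₂) (hu₀ i₄)
    (t i₁) (t i₂) (t i₃) (t i₄)
  refine ⟨hsector.trans ?_, fun hcond₁ hcond₂ ⟨x, hxS, hx⟩ => ?_⟩
  · simpa only [proj_image_halfPlane] using sectorConditions_iff_exists_isCode hu hu₀ h₁₂.ne
      (h₁₂.trans (h₂₃.trans h₃₄)).ne h₂₃.ne (h₂₃.trans h₃₄).ne h₃₄.ne
  have hstrict := (hsector.1 ⟨hcond₁, hcond₂⟩).strict (hu _ _ h₁₂.ne)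
    (hu _ _ (h₂₃.trans h₃₄).ne) (hu _ _ h₃₄.ne)
  obtain ⟨g, hg₁, hg₂, hg₃, hg₄, hg⟩ := h𝔹.isConvexConcaveFamily.exists_isSectorialLine hstrict
    (ht h₁₂) (ht h₂₃) (ht h₃₄) (hpos i₁) (hpos i₂) (hpos i₃) (hpos i₄)
    ⟨x, hxS, (mem_projCompl_halfPlane (hu₀ i₄)).1 hx⟩
  obtain ⟨A, B, C, D, hcross⟩ := hg.exists_crossesInOrder hstrict (ht h₁₂) (ht h₂₃) (ht h₃₄)
  obtain ⟨ne₂, ne₃, ne₄, hline⟩ := hg.inter_nonempty (hu₀ i₁) (hu₀ i₄) _ _ _ _ hg₁ hg₂ hg₃ hg₄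
  refine ⟨ne₂, ne₃, ne₄, hline, fun l hl p₁ hp₁ p₂ hp₂ p₃ hp₃ p₄ hp₄ => ?_,
    hcross.directionRatio_lt_heightRatio (ht h₂₃).le⟩
  obtain ⟨f, rfl, eq₁, eq₂, eq₃, eq₄, hf⟩ := exists_isSectorialLine_eq_graphLine (hu₀ i₁) (hu₀ i₄)
    (ht h₁₂).ne (hpos i₁) (hpos i₂) (hpos i₃) (hpos i₄) hl hp₁ hp₂ hp₃ hp₄
  rw [eq₁, eq₂, eq₃, eq₄]
  exact hf.exists_inter_frontier_eq_singleton_and_doubleRatio_eq hstrict (ht h₁₂) (ht h₂₃) (ht h₃₄)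
    (hu₀ i₁) (hu₀ i₂) (hu₀ i₃) (hu₀ i₄) _ _ _ _
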